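/- **Setting.** Fix $T>0$ and write $\|\cdot\|$, $\langle\cdot,\cdot\rangle$ for the norm and inner product of $L^2(\mathbb R)$. Let $w$ be a bounded probability density on $\mathbb R$ and let $F\in C^2(\mathbb R)$ have bounded derivatives $F',F''$. Let $\hat u$ be a differentiable travelling front profile with speed $c\in\mathbb R$, that is, $-c\,\hat u_x=-\hat u+w*F(\hat u)$, $\hat u(-\infty)=0$, $\hat u(+\infty)=1$, $\hat u_x\in L^1(\mathbb R)$ (then also $\hat u_x\in L^2(\mathbb R)$). Let $W^Q$ be a $Q$-Wiener process on $L^2(\mathbb R)$, with $Q$ nonnegative, symmetric and of trace class, on a filtered probability space $(\Omega,\mathcal F,(\mathcal F_t),P)$. Assume the spectral gap condition: there are $\kappa_*,C_*>0$ such that for every $a\in\mathbb R$ and every $z\in L^2(\mathbb R)$ $$\big\langle -z+w*\big(F'(\hat u(\cdot-a))z\big),z\big\rangle\le-\kappa_*\|z\|^2+C_*\langle \hat u_x(\cdot-a),z\rangle^2,$$ and let $m>C_*$. For each $\varepsilon>0$ let $u_t=\hat u(\cdot-ct)+v_t$ be the solution of $du_t=[-u_t+w*F(u_t)]\,dt+\sqrt\varepsilon\,dW^Q_t$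 with $u_0=\hat u$, where $v$ is a strong solution, with continuous paths in $L^2(\mathbb R)$, of $$dv_t=\big[-v_t+w*\big(F(v_t+\hat u(\cdot-ct))-F(\hat u(\cdot-ct))\big)\big]dt+\sqrt\varepsilon\,dW^Q_t,\qquad v_0=0.$$ Let $C$ be a solution on $[0,T]$ of the pathwise equation $\dot C(t)=-m\langle\hat u_x(\cdot-ct-C(t)),\,u_t-\hat u(\cdot-ct-C(t))\rangle$, $C(0)=0$, and set $$\tilde v_t=u_t-\hat u(\cdot-ct-C(t)),\qquad \tilde v^\varepsilon_t=\varepsilon^{-1/2}\tilde v_t .$$ Put $A(t)z=-z+w*\big(F'(\hat u(\cdot-ct-C(t)))z\big)-m\langle\hat u_x(\cdot-ct-C(t)),z\rangle\,\hat u_x(\cdot-ct-C(t))$, let $Z$ be a strong solution, with continuous paths in $L^2(\mathbb R)$, of $dZ_t=A(t)Z_t\,dt+dW^Q_t$, $Z_0=0$, and let $y^\varepsilon_t=\tilde v^\varepsilon_t-Z_t$ be the remainder. (The processes $u,v,C,A,Z$ all depend on $\varepsilon$.) **Theorem (stability).** Let $q\in(0,1/2)$, let $$K=\tfrac12\|F''\|_\infty\Big(\sup_{y,\tilde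 y\in\mathbb R}\int_{\mathbb R}w(x-y)\,w(x-\tilde y)\,dx\Big)^{1/2},$$ and for $\varepsilon>0$ let $$\tau=\inf\Big\{t\ge0:\int_0^t\|\tilde v^\varepsilon_s\|^2\,ds>\varepsilon^{-q}\Big\}\wedge T .$$ Then: 1. for every $\varepsilon>0$, almost surely, $\displaystyle\sup_{t\in[0,\tau]}\|y^\varepsilon_t\|\le K\,\varepsilon^{1/2-q}$; 2. $\displaystyle\lim_{\varepsilon\to0}P[\tau=T]=1$; 3. consequently, with probability tending to $1$ as $\varepsilon\to0$, $u_t=\hat u(\cdot-ct-C(t))+\sqrt\varepsilon\,Z_t+r_t$ for all $t\in[0,T]$, with $\|r_t\|\le K\,\varepsilon^{1-q}$. -/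

import Mathlib

open MeasureTheory ProbabilityTheory Filter Topology Set
open scoped Convolution

noncomputable section

namespace NeuralField

/-- The Hilbert space `L²(ℝ)`. -/
abbrev L2R : Type := Lp ℝ 2 (volume : Measure ℝ)

open Classical in
/-- The element of `L²(ℝ)` given by a square integrable function. It is only applied to functions
which are square integrable in the setting of the theorem; the value `0` elsewhere is a default. -/
def toL2 (f : ℝ → ℝ) : L2R :=
  if h : MemLp f 2 (volume : Measure ℝ) then h.toLp f else 0

/-! ### The deterministic data -/

/-- The weight kernel is a bounded probability density. -/
structure IsKernel (w : ℝ → ℝ) : Prop where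
  nonneg : ∀ x, 0 ≤ w x
  bounded : ∃ M, ∀ x, w x ≤ M
  integrable : Integrable w
  integral_eq_one : ∫ x, w x = 1

/-- The gain function is twice continuously differentiable, and its first and second derivative
are bounded. -/
structure IsGain (F : ℝ → ℝ) : Prop where
  contDiff : ContDiff ℝ 2 F
  bounded_deriv : ∃ M, ∀ x, |deriv F x| ≤ M
  bounded_deriv2 : ∃ M, ∀ x, |deriv (deriv F) x| ≤ M

/-- `U` is the profile of a travelling front with speed `c` of the deterministic neural field
equation, connecting `0` to `1`: `-c U' = -U + w ∗ F(U)`, with integrable gradient `U'`. -/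
structure IsTravellingWave (w F : ℝ → ℝ) (c : ℝ) (U : ℝ → ℝ) : Prop where
  differentiable : Differentiable ℝ U
  integrable_deriv : Integrable (deriv U)
  equation : ∀ x, -c * deriv U x = -U x + (w ⋆ fun y => F (U y)) x
  tendsto_atBot : Tendsto U atBot (𝓝 0)
  tendsto_atTop : Tendsto U atTop (𝓝 1)

/-- The gradient `U'(· - a)` of the translated profile, as an element of `L²(ℝ)`. -/
def gradWave (U : ℝ → ℝ) (a : ℝ) : L2R := toL2 fun x => deriv U (x - a)

/-- The linearization `A⁰ z = -z + w ∗ (F'(U(· - a)) z)` at the profile translated by `a`. -/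
def opA0 (w F U : ℝ → ℝ) (a : ℝ) (z : L2R) : L2R :=
  -z + toL2 (w ⋆ fun y => deriv F (U (y - a)) * z y)

/-- The operator `A z = A⁰ z - m ⟨U'(· - a), z⟩ U'(· - a)`. -/
def opA (w F U : ℝ → ℝ) (m a : ℝ) (z : L2R) : L2R :=
  opA0 w F U a z - (m * inner ℝ (gradWave U a) z) • gradWave U a

/-- The spectral gap condition
`⟨A⁰ z, z⟩ ≤ -κ ‖z‖² + Cs ⟨U'(· - a), z⟩²` for all `z ∈ L²(ℝ)`, along the translated profiles. -/
def SpectralGap (w F U : ℝ → ℝ) (κ Cs : ℝ) : Prop :=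
  ∀ (a : ℝ) (z : L2R),
    inner ℝ (opA0 w F U a z) z ≤ -κ * ‖z‖ ^ 2 + Cs * (inner ℝ (gradWave U a) z) ^ 2

/-- The constant `½ ‖F''‖_∞ (sup_{y, y'} ∫ w(x - y) w(x - y') dx)^{1/2}`. -/
def remainderConst (w F : ℝ → ℝ) : ℝ :=
  1 / 2 * (⨆ x : ℝ, |deriv (deriv F) x|) *
    Real.sqrt (⨆ p : ℝ × ℝ, ∫ x, w (x - p.1) * w (x - p.2))

/-! ### Wiener processes and strong solutions -/

section Stochastic

variable {Ω : Type*} [mΩ : MeasurableSpace Ω]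

/-- `Q` is a nonnegative symmetric operator of finite trace. -/
def IsTraceClassCovariance (Q : L2R →L[ℝ] L2R) : Prop :=
  Q.IsPositive ∧ ∃ b : HilbertBasis ℕ ℝ L2R, Summable fun i => inner ℝ (Q (b i)) (b i)

/-- `W` is a `Q`-Wiener process in `L²(ℝ)` on the time interval `[0, T]` with respect to the
filtration `ℱ`. The law of an increment is described through its one-dimensional projections,
which characterize the centred Gaussian law with covariance `(t - s) Q`. -/
structure IsQWiener (T : ℝ) (P : Measure Ω) (ℱ : Filtration ℝ mΩ) (Q : L2R →L[ℝ] L2R)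
    (W : ℝ → Ω → L2R) : Prop where
  covariance : IsTraceClassCovariance Q
  adapted : ∀ t ∈ Icc 0 T, StronglyMeasurable[ℱ t] (W t)
  zero : ∀ᵐ ω ∂P, W 0 ω = 0
  continuous : ∀ᵐ ω ∂P, ContinuousOn (fun t => W t ω) (Icc 0 T)
  gaussian : ∀ s t, 0 ≤ s → s ≤ t → t ≤ T → ∀ h : L2R,
    HasLaw (fun ω => inner ℝ h (W t ω - W s ω))
      (gaussianReal 0 (Real.toNNReal ((t - s) * inner ℝ (Q h) h))) P
  indep : ∀ s t, 0 ≤ s → s ≤ t → t ≤ T →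
    Indep (MeasurableSpace.comap (fun ω => W t ω - W s ω) (borel L2R)) (ℱ s) P

/-- `X` is a strong solution with continuous paths on `[0, T]` of
`dX = b(t, ω, X) dt + σ dW`, `X(0) = 0`. -/
structure IsStrongSolution (T : ℝ) (P : Measure Ω) (ℱ : Filtration ℝ mΩ) (W : ℝ → Ω → L2R)
    (b : ℝ → Ω → L2R → L2R) (σ : ℝ) (X : ℝ → Ω → L2R) : Prop where
  adapted : ∀ t ∈ Icc 0 T, StronglyMeasurable[ℱ t] (X t)
  continuous : ∀ᵐ ω ∂P, ContinuousOn (fun t => X t ω) (Icc 0 T)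
  integrable : ∀ᵐ ω ∂P, IntervalIntegrable (fun s => b s ω (X s ω)) volume 0 T
  equation : ∀ᵐ ω ∂P, ∀ t ∈ Icc 0 T,
    X t ω = (∫ s in (0 : ℝ)..t, b s ω (X s ω)) + σ • W t ω

end Stochastic

/-! ### The stochastic neural field and its decomposition -/

/-- The drift `v ↦ -v + w ∗ (F(v + U(· - ct)) - F(U(· - ct)))` of the equation for
`v = u - U(· - ct)`, where `u` solves `du = [-u + w ∗ F(u)] dt + √ε dW`, `u(0) = U`. -/
def driftV (w F U : ℝ → ℝ) (c t : ℝ) (v : L2R) : L2R :=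
  -v + toL2 (w ⋆ fun y => F (v y + U (y - c * t)) - F (U (y - c * t)))

/-- The neural field `u(t, x) = U(x - ct) + v(x)`. -/
def field (U : ℝ → ℝ) (c t : ℝ) (v : L2R) (x : ℝ) : ℝ := U (x - c * t) + v x

/-- The fluctuation `u(t, ·) - U(· - ct - C)` around the front with phase shift `C`. -/
def fluctuation (U : ℝ → ℝ) (c t : ℝ) (v : L2R) (C : ℝ) : L2R :=
  toL2 fun x => field U c t v x - U (x - c * t - C)

/-- `C` solves, on `[0, T]`, the gradient-descent-type phase equation
`C' = -m ⟨U'(· - ct - C), u(t, ·) - U(· - ct - C)⟩`, `C(0) = 0`, for the path `v = u - U(· - ct)`. -/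
def IsPhase (T : ℝ) (U : ℝ → ℝ) (c m : ℝ) (v : ℝ → L2R) (C : ℝ → ℝ) : Prop :=
  C 0 = 0 ∧ ∀ t ∈ Icc 0 T, HasDerivWithinAt C
    (-m * inner ℝ (gradWave U (c * t + C t)) (fluctuation U c t (v t) (C t))) (Icc 0 T) t

/-- The rescaled fluctuation `ṽ^ε = ε^{-1/2} (u - U(· - ct - C))`. -/
def scaledFluctuation (U : ℝ → ℝ) (c ε t : ℝ) (v : L2R) (C : ℝ) : L2R :=
  (Real.sqrt ε)⁻¹ • fluctuation U c t v C

/-- The time `inf {t ≥ 0 | ∫₀ᵗ ‖x(s)‖² ds > R} ∧ T` for a process `x`. -/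
def exitTime {Ω : Type*} (T R : ℝ) (x : ℝ → Ω → L2R) : Ω → ℝ :=
  hittingBtwn (fun t ω => ∫ s in (0 : ℝ)..t, ‖x s ω‖ ^ 2) (Ioi R) 0 T

end NeuralField

end

namespace NeuralField

open scoped ENNReal

/-! ### Square integrable functions as elements of `L²(ℝ)` -/

/-! The argument is pathwise. The noise is additive, so in `y = ε^{-1/2} ṽ - Z` it cancels and `y`
is differentiable in time. Expanding `F` around the shifted front gives `y' = A y + ε^{-1/2} R(ṽ)`
(`driftV_add_eq`); the phase equation is exactly what produces the rank-one term of `A`.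

Two estimates control this equation. The spectral gap with `m > Cs` makes `A` dissipative
(`inner_opA_nonpos`). The Taylor remainder of `F` is bounded in `L¹` by `‖z‖²`, and convolution with
`w` maps `L¹` to `L²`, whence `‖R(z)‖ ≤ K ‖z‖²` (`norm_quadRemainder_le`). The energy estimate
`norm_le_integral_of_inner_deriv_le` then yields `‖y_t‖ ≤ K √ε ∫₀ᵗ ‖ṽ^ε‖²`, which is at most `K
ε^{1/2-q}` up to `τ`.

For the exit time, the same energy estimate applied to `Z - W` bounds `Z` by `sup ‖W‖`, uniformly in
`ε` (`norm_Z_le`). Before `τ` one has `‖ṽ^ε‖ ≤ ‖y‖ + ‖Z‖`, which stays bounded, so for small `ε` the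
integral cannot reach `ε^{-q}` by time `T` (`exitTime_eq_of_bounded`). Continuous paths have finite
`sup ‖W‖`, so this covers events of probability close to one (`tendsto_measure_one_of_tight`).

On the analytic side, `U` is not in `L²`, but differences of its translates are, and `b ↦ U - U(· -
b)` is a differentiable curve in `L²` (`hasDerivAt_toL2_sub`). -/

theorem toL2_of_memLp {f : ℝ → ℝ} (hf : MemLp f 2) : toL2 f = hf.toLp f := dif_pos hf

theorem coeFn_toL2 {f : ℝ → ℝ} (hf : MemLp f 2) : toL2 f =ᵐ[volume] f := by
  rw [toL2_of_memLp hf]; exact hf.coeFn_toLp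

theorem toL2_congr {f g : ℝ → ℝ} (h : f =ᵐ[volume] g) : toL2 f = toL2 g := by
  by_cases hf : MemLp f 2
  · rw [toL2_of_memLp hf, toL2_of_memLp (hf.ae_eq h)]
    exact MemLp.toLp_congr _ _ h
  · rw [toL2, toL2, dif_neg hf, dif_neg fun hg => hf (hg.ae_eq h.symm)]

theorem toL2_coe (z : L2R) : toL2 z = z := by
  rw [toL2_of_memLp (Lp.memLp z)]; exact Lp.toLp_coeFn z _

theorem toL2_add {f g : ℝ → ℝ} (hf : MemLp f 2) (hg : MemLp g 2) :
    toL2 (fun x => f x + g x) = toL2 f + toL2 g := by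
  rw [toL2_of_memLp hf, toL2_of_memLp hg]
  exact toL2_of_memLp (hf.add hg)

theorem toL2_sub {f g : ℝ → ℝ} (hf : MemLp f 2) (hg : MemLp g 2) :
    toL2 (fun x => f x - g x) = toL2 f - toL2 g := by
  rw [toL2_of_memLp hf, toL2_of_memLp hg]
  exact toL2_of_memLp (hf.sub hg)

theorem toL2_const_mul {f : ℝ → ℝ} (hf : MemLp f 2) (r : ℝ) :
    toL2 (fun x => r * f x) = r • toL2 f := by
  rw [toL2_of_memLp hf, toL2_of_memLp (hf.const_mul r)]; rfl

theorem norm_toL2 {f : ℝ → ℝ} (hf : MemLp f 2) : ‖toL2 f‖ = (eLpNorm f 2).toReal := by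
  rw [toL2_of_memLp hf, Lp.norm_toLp]

theorem norm_toL2_le_mul_norm {f : ℝ → ℝ} (hf : MemLp f 2) {r : ℝ} {z : L2R}
    (h : ∀ᵐ x, |f x| ≤ r * |z x|) : ‖toL2 f‖ ≤ r * ‖z‖ := by
  refine Lp.norm_le_mul_norm_of_ae_le_mul ?_
  filter_upwards [h, coeFn_toL2 hf] with x h1 h2
  rw [h2]; exact h1

theorem inner_toL2 (h : L2R) {f : ℝ → ℝ} (hf : MemLp f 2) :
    inner ℝ h (toL2 f) = ∫ x, h x * f x := by
  rw [L2.inner_def]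
  refine integral_congr_ae ?_
  filter_upwards [coeFn_toL2 hf] with x hx
  rw [hx]; simp [mul_comm]

theorem memLp_two_of_integrable_of_bounded {f : ℝ → ℝ} (hf : Integrable f) {M : ℝ}
    (hM : ∀ x, |f x| ≤ M) : MemLp f 2 := by
  rw [memLp_two_iff_integrable_sq hf.aestronglyMeasurable]
  refine (hf.norm.const_mul M).mono' (hf.aestronglyMeasurable.pow 2) (ae_of_all _ fun x => ?_)
  rw [norm_pow, sq]
  exact mul_le_mul_of_nonneg_right (hM x) (norm_nonneg _)

theorem memLp_comp_sub {f : ℝ → ℝ} {p : ℝ≥0∞} (hf : MemLp f p) (a : ℝ) :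
    MemLp (fun x => f (x - a)) p :=
  hf.comp_measurePreserving (measurePreserving_sub_right volume a)

theorem memLp_comp_sub_left {f : ℝ → ℝ} {p : ℝ≥0∞} (hf : MemLp f p) (a : ℝ) :
    MemLp (fun x => f (a - x)) p :=
  hf.comp_measurePreserving (Measure.measurePreserving_sub_left volume a)

/-! ### Young's inequality `‖f ⋆ g‖₂ ≤ ‖f‖₁ ‖g‖₂` -/

theorem sq_eLpNorm_two {α : Type*} [MeasurableSpace α] {μ : Measure α} (f : α → ℝ) :
    eLpNorm f 2 μ ^ 2 = ∫⁻ x, ‖f x‖ₑ ^ 2 ∂μ := by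
  have h := eLpNorm_nnreal_pow_eq_lintegral (μ := μ) (f := f) (p := 2) (by norm_num)
  simpa using h

/-- Cauchy–Schwarz for the measure `f dμ`: split `f g = f^{1/2} (f g²)^{1/2}`. -/
theorem sq_lintegral_mul_le {α : Type*} [MeasurableSpace α] {μ : Measure α} {f g : α → ℝ≥0∞}
    (hf : AEMeasurable f μ) (hg : AEMeasurable g μ) :
    (∫⁻ x, f x * g x ∂μ) ^ 2 ≤ (∫⁻ x, f x ∂μ) * ∫⁻ x, f x * g x ^ 2 ∂μ := by
  have h := ENNReal.lintegral_mul_norm_pow_le (p := 1 / 2) (q := 1 / 2) hf (hf.mul (hg.pow_const 2))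
    (by norm_num) (by norm_num) (by norm_num)
  have e : ∀ x, f x ^ (1 / 2 : ℝ) * (f * fun x => g x ^ 2) x ^ (1 / 2 : ℝ) = f x * g x := by
    intro x
    rw [← ENNReal.mul_rpow_of_nonneg _ _ (by norm_num), Pi.mul_apply, ← mul_assoc, ← sq, ← mul_pow,
      ← ENNReal.rpow_natCast, ← ENNReal.rpow_mul]
    norm_num
  simp_rw [e] at h
  refine (pow_le_pow_left' h 2).trans_eq ?_
  rw [← ENNReal.mul_rpow_of_nonneg _ _ (by norm_num), ← ENNReal.rpow_natCast, ← ENNReal.rpow_mul]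
  norm_num

theorem aestronglyMeasurable_convolution {f g : ℝ → ℝ} (hf : AEStronglyMeasurable f)
    (hg : AEStronglyMeasurable g) : AEStronglyMeasurable (f ⋆ g) :=
  (hf.convolution_integrand (μ := volume) (ContinuousLinearMap.lsmul ℝ ℝ) hg).integral_prod_right'

/-- Cauchy–Schwarz against `|f(t)| dt`, then Tonelli and translation invariance. Everything lives in
`[0, ∞]`, so no integrability is needed. -/
theorem eLpNorm_convolution_le {f g : ℝ → ℝ} (hf : AEStronglyMeasurable f)
    (hg : AEStronglyMeasurable g) :
    eLpNorm (f ⋆ g) 2 ≤ eLpNorm f 1 * eLpNorm g 2 := by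
  have hgx : ∀ x, AEStronglyMeasurable fun t => g (x - t) := fun x =>
    hg.comp_measurePreserving (Measure.measurePreserving_sub_left volume x)
  have hm : AEMeasurable (fun p : ℝ × ℝ => ‖f p.2‖ₑ * ‖g (p.1 - p.2)‖ₑ ^ 2)
      (volume.prod volume) := by
    -- The convolution integrand with the constant `1` as first factor is exactly `g(x - t)`.
    have h1 : AEStronglyMeasurable (fun p : ℝ × ℝ => g (p.1 - p.2)) (volume.prod volume) := by
      simpa using (aestronglyMeasurable_const (b := (1 : ℝ))).convolution_integrand
        (ContinuousLinearMap.lsmul ℝ ℝ) hg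
    have h2 : AEStronglyMeasurable (fun p : ℝ × ℝ => f p.2) (volume.prod volume) := hf.comp_snd
    exact h2.enorm.mul (h1.enorm.pow_const 2)
  have key : eLpNorm (f ⋆ g) 2 ^ 2 ≤ (eLpNorm f 1 * eLpNorm g 2) ^ 2 := by
    rw [mul_pow, sq_eLpNorm_two, sq_eLpNorm_two, eLpNorm_one_eq_lintegral_enorm]
    calc ∫⁻ x, ‖(f ⋆ g) x‖ₑ ^ 2
        ≤ ∫⁻ x, (∫⁻ t, ‖f t‖ₑ * ‖g (x - t)‖ₑ) ^ 2 := by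
          refine lintegral_mono fun x => pow_le_pow_left' ?_ 2
          rw [convolution_lsmul]
          refine (enorm_integral_le_lintegral_enorm _).trans_eq ?_
          simp_rw [smul_eq_mul, enorm_mul]
      _ ≤ ∫⁻ x, (∫⁻ t, ‖f t‖ₑ) * ∫⁻ t, ‖f t‖ₑ * ‖g (x - t)‖ₑ ^ 2 :=
          lintegral_mono fun x => sq_lintegral_mul_le hf.enorm (hgx x).enorm
      _ = (∫⁻ t, ‖f t‖ₑ) * ∫⁻ x, ∫⁻ t, ‖f t‖ₑ * ‖g (x - t)‖ₑ ^ 2 :=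
          lintegral_const_mul'' _ hm.lintegral_prod_right'
      _ = (∫⁻ t, ‖f t‖ₑ) * ∫⁻ t, ∫⁻ x, ‖f t‖ₑ * ‖g (x - t)‖ₑ ^ 2 := by
          rw [lintegral_lintegral_swap hm]
      _ = (∫⁻ t, ‖f t‖ₑ) * ∫⁻ t, ‖f t‖ₑ * ∫⁻ x, ‖g x‖ₑ ^ 2 := by
          congr 1
          refine lintegral_congr fun t => ?_
          have hgt : AEStronglyMeasurable fun x => g (x - t) :=
            hg.comp_measurePreserving (measurePreserving_sub_right volume t)
          rw [lintegral_const_mul'' _ (hgt.enorm.pow_const 2),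
            lintegral_sub_right_eq_self (fun x => ‖g x‖ₑ ^ 2) t]
      _ = (∫⁻ t, ‖f t‖ₑ) ^ 2 * ∫⁻ x, ‖g x‖ₑ ^ 2 := by
          rw [lintegral_mul_const'' _ hf.enorm, sq, mul_assoc]
  exact (ENNReal.pow_le_pow_left_iff two_ne_zero).1 key

theorem memLp_convolution {f g : ℝ → ℝ} (hf : Integrable f) (hg : MemLp g 2) :
    MemLp (f ⋆ g) 2 :=
  ⟨aestronglyMeasurable_convolution hf.1 hg.1, (eLpNorm_convolution_le hf.1 hg.1).trans_lt
    (ENNReal.mul_lt_top (memLp_one_iff_integrable.2 hf).2 hg.2)⟩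

/-! ### Convolution with the kernel as an operator on `L²(ℝ)` -/

variable {w : ℝ → ℝ}

theorem IsKernel.memLp_two (hw : IsKernel w) : MemLp w 2 := by
  obtain ⟨M, hM⟩ := hw.bounded
  exact memLp_two_of_integrable_of_bounded hw.integrable fun x => by
    rw [abs_of_nonneg (hw.nonneg x)]; exact hM x

theorem IsKernel.eLpNorm_one (hw : IsKernel w) : eLpNorm w 1 = 1 := by
  rw [eLpNorm_one_eq_lintegral_enorm, ← ofReal_integral_norm_eq_lintegral_enorm hw.integrable]
  simp_rw [Real.norm_of_nonneg (hw.nonneg _), hw.integral_eq_one, ENNReal.ofReal_one]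

theorem IsKernel.convolutionExistsAt_of_memLp (hw : IsKernel w) {f : ℝ → ℝ} (hf : MemLp f 2)
    (x : ℝ) : ConvolutionExistsAt w f x (ContinuousLinearMap.lsmul ℝ ℝ) volume :=
  hw.memLp_two.integrable_mul (memLp_comp_sub_left hf x)

theorem IsKernel.convolutionExistsAt_of_bounded (hw : IsKernel w) {f : ℝ → ℝ}
    (hf : AEStronglyMeasurable f) {M : ℝ} (hM : ∀ x, |f x| ≤ M)
    (x : ℝ) : ConvolutionExistsAt w f x (ContinuousLinearMap.lsmul ℝ ℝ) volume :=
  hw.integrable.mul_bdd (c := M)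
    (hf.comp_measurePreserving (Measure.measurePreserving_sub_left volume x))
    (ae_of_all _ fun _ => hM _)

theorem convolution_congr_ae {f g : ℝ → ℝ} (h : f =ᵐ[volume] g) : w ⋆ f = w ⋆ g :=
  convolution_congr _ ae_eq_rfl h

theorem norm_toL2_convolution_le (hw : IsKernel w) (z : L2R) : ‖toL2 (w ⋆ z)‖ ≤ ‖z‖ := by
  rw [norm_toL2 (memLp_convolution hw.integrable (Lp.memLp z)), Lp.norm_def]
  refine ENNReal.toReal_mono (Lp.memLp z).2.ne ?_
  simpa [hw.eLpNorm_one] using eLpNorm_convolution_le hw.integrable.1 (Lp.memLp z).1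

/-- Convolution with `w` as a bounded operator on `L²(ℝ)`. -/
noncomputable def convCLM (hw : IsKernel w) : L2R →L[ℝ] L2R :=
  LinearMap.mkContinuous
    { toFun := fun z => toL2 (w ⋆ z)
      map_add' := fun y z => by
        rw [← toL2_add (memLp_convolution hw.integrable (Lp.memLp y))
          (memLp_convolution hw.integrable (Lp.memLp z)), convolution_congr_ae (Lp.coeFn_add y z)]
        congr 1
        funext x
        exact (hw.convolutionExistsAt_of_memLp (Lp.memLp y) x).distrib_add
          (hw.convolutionExistsAt_of_memLp (Lp.memLp z) x)
      map_smul' := fun r z => by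
        rw [convolution_congr_ae (Lp.coeFn_smul r z), convolution_smul]
        exact toL2_const_mul (memLp_convolution hw.integrable (Lp.memLp z)) r }
    1 fun z => (norm_toL2_convolution_le hw z).trans_eq (one_mul _).symm

theorem toL2_convolution (hw : IsKernel w) {f : ℝ → ℝ} (hf : MemLp f 2) :
    toL2 (w ⋆ f) = convCLM hw (toL2 f) := by
  change _ = toL2 (w ⋆ toL2 f)
  rw [convolution_congr_ae (coeFn_toL2 hf)]

theorem norm_convCLM_le (hw : IsKernel w) (z : L2R) : ‖convCLM hw z‖ ≤ ‖z‖ :=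
  norm_toL2_convolution_le hw z

/-- `‖w‖₂²` is the member of the family at `p = (0, 0)`. The bound `M` on the family is needed
because an unbounded real supremum defaults to `0`. -/
theorem sq_eLpNorm_kernel_le (hw : IsKernel w) :
    eLpNorm w 2 ^ 2 ≤ ENNReal.ofReal (⨆ p : ℝ × ℝ, ∫ x, w (x - p.1) * w (x - p.2)) := by
  obtain ⟨M, hM⟩ := hw.bounded
  have hb : BddAbove (range fun p : ℝ × ℝ => ∫ x, w (x - p.1) * w (x - p.2)) := by
    refine ⟨M, ?_⟩
    rintro _ ⟨p, rfl⟩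
    calc ∫ x, w (x - p.1) * w (x - p.2) ≤ ∫ x, M * w (x - p.2) :=
          integral_mono ((memLp_comp_sub hw.memLp_two p.1).integrable_mul
            (memLp_comp_sub hw.memLp_two p.2)) ((hw.integrable.comp_sub_right p.2).const_mul M)
            fun x => mul_le_mul_of_nonneg_right (hM _) (hw.nonneg _)
      _ = M := by
          rw [integral_const_mul, integral_sub_right_eq_self w, hw.integral_eq_one, mul_one]
  have h0 := le_ciSup hb (0, 0)
  refine le_trans (le_of_eq ?_) (ENNReal.ofReal_le_ofReal h0)
  rw [sq_eLpNorm_two, ofReal_integral_eq_lintegral_ofReal]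
  · refine lintegral_congr fun x => ?_
    simp only [sub_zero]
    rw [ENNReal.ofReal_mul (hw.nonneg x), ← sq, Real.enorm_of_nonneg (hw.nonneg x)]
  · simp only [sub_zero]
    exact hw.memLp_two.integrable_mul hw.memLp_two
  · exact ae_of_all _ fun x => mul_nonneg (hw.nonneg _) (hw.nonneg _)

/-- Young's inequality with the roles exchanged: by commutativity the `L¹` norm falls on `f` and the
`L²` norm on `w`. -/
theorem norm_convCLM_toL2_le (hw : IsKernel w) {f : ℝ → ℝ} (hf : MemLp f 2) (hf1 : Integrable f) :
    ‖convCLM hw (toL2 f)‖ ≤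
      Real.sqrt (⨆ p : ℝ × ℝ, ∫ x, w (x - p.1) * w (x - p.2)) * ∫ x, |f x| := by
  rw [← toL2_convolution hw hf, norm_toL2 (memLp_convolution hw.integrable hf)]
  have hflip : w ⋆ f = f ⋆ w := by
    funext x
    rw [convolution_lsmul_swap, convolution_lsmul]
    simp_rw [smul_eq_mul, mul_comm]
  have h := eLpNorm_convolution_le hf1.1 hw.integrable.1
  rw [hflip]
  refine (ENNReal.toReal_mono (ENNReal.mul_ne_top (memLp_one_iff_integrable.2 hf1).2.ne
    hw.memLp_two.2.ne) h).trans ?_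
  rw [ENNReal.toReal_mul, mul_comm]
  refine mul_le_mul (Real.le_sqrt_of_sq_le ?_) (le_of_eq ?_) ENNReal.toReal_nonneg
    (Real.sqrt_nonneg _)
  · rw [← ENNReal.toReal_pow]
    refine ENNReal.toReal_le_of_le_ofReal (Real.iSup_nonneg fun p => integral_nonneg fun x =>
      mul_nonneg (hw.nonneg _) (hw.nonneg _)) (sq_eLpNorm_kernel_le hw)
  · rw [eLpNorm_one_eq_lintegral_enorm, ← integral_norm_eq_lintegral_enorm hf1.1]; rfl

/-! ### Consequences of the bounds on the gain function -/

section Gain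

variable {F : ℝ → ℝ}

theorem IsGain.differentiable (hF : IsGain F) : Differentiable ℝ F :=
  hF.contDiff.differentiable (by norm_num)

theorem IsGain.contDiff_deriv (hF : IsGain F) : ContDiff ℝ 1 (deriv F) :=
  ((contDiff_succ_iff_deriv (n := 1)).1 hF.contDiff).2.2

theorem IsGain.differentiable_deriv (hF : IsGain F) : Differentiable ℝ (deriv F) :=
  hF.contDiff_deriv.differentiable (by norm_num)

theorem IsGain.abs_deriv2_le (hF : IsGain F) (x : ℝ) :
    |deriv (deriv F) x| ≤ ⨆ x, |deriv (deriv F) x| := by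
  obtain ⟨M, hM⟩ := hF.bounded_deriv2
  exact le_ciSup (f := fun x => |deriv (deriv F) x|) ⟨M, by rintro _ ⟨x, rfl⟩; exact hM x⟩ x

theorem abs_sub_le_of_abs_deriv_le {f : ℝ → ℝ} (hf : Differentiable ℝ f) {M : ℝ}
    (hM : ∀ x, |deriv f x| ≤ M) (x y : ℝ) : |f x - f y| ≤ M * |x - y| :=
  convex_univ.norm_image_sub_le_of_norm_deriv_le (fun z _ => hf z) (fun z _ => hM z)
    (mem_univ y) (mem_univ x)

theorem IsGain.abs_deriv_sub_le (hF : IsGain F) (x y : ℝ) :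
    |deriv F x - deriv F y| ≤ (⨆ x, |deriv (deriv F) x|) * |x - y| :=
  abs_sub_le_of_abs_deriv_le hF.differentiable_deriv hF.abs_deriv2_le x y

/-- Along `θ ↦ θ z + u` the error has derivative at most `G z² θ`, since `F'` is Lipschitz with
constant `G`; compare with `½ G z² θ²` on `[0, 1]`. -/
theorem IsGain.abs_taylor_le (hF : IsGain F) (u z : ℝ) :
    |F (z + u) - F u - deriv F u * z| ≤ 1 / 2 * (⨆ x, |deriv (deriv F) x|) * z ^ 2 := by
  set G := ⨆ x, |deriv (deriv F) x|
  have hd : ∀ θ : ℝ, HasDerivAt (fun θ => F (θ * z + u) - F u - θ * (deriv F u * z))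
      (deriv F (θ * z + u) * z - deriv F u * z) θ := fun θ => by
    have h1 : HasDerivAt (fun θ : ℝ => θ * z + u) z θ := by
      simpa using ((hasDerivAt_id θ).mul_const z).add_const u
    have h2 := ((hF.differentiable (θ * z + u)).hasDerivAt.comp θ h1).sub_const (F u)
    simpa using! h2.sub ((hasDerivAt_id θ).mul_const (deriv F u * z))
  have hB : ∀ θ : ℝ, HasDerivAt (fun θ : ℝ => 1 / 2 * G * z ^ 2 * θ ^ 2) (G * z ^ 2 * θ) θ :=
    fun θ => by
      refine ((hasDerivAt_pow 2 θ).const_mul (1 / 2 * G * z ^ 2)).congr_deriv ?_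
      norm_num; ring
  have h := image_norm_le_of_norm_deriv_right_le_deriv_boundary (a := 0) (b := 1)
    (fun θ _ => (hd θ).continuousAt.continuousWithinAt) (fun θ _ => (hd θ).hasDerivWithinAt)
    (by simp) hB (fun θ hθ => ?_) (right_mem_Icc.2 zero_le_one)
  · simpa using h
  · rw [← sub_mul, norm_mul, Real.norm_eq_abs, Real.norm_eq_abs]
    refine (mul_le_mul_of_nonneg_right (hF.abs_deriv_sub_le _ _) (abs_nonneg z)).trans_eq ?_
    rw [add_sub_cancel_right, abs_mul, abs_of_nonneg hθ.1, ← sq_abs z]; ring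

/-- Mean value inequality in `z` rather than in `u`. The factor `|z|` is what makes the bound square
integrable when `z` is an `L²` function. -/
theorem IsGain.abs_increment_sub_le (hF : IsGain F) (u u' z : ℝ) :
    |(F (z + u) - F u) - (F (z + u') - F u')| ≤
      (⨆ x, |deriv (deriv F) x|) * |u - u'| * |z| := by
  have hd : ∀ (v : ℝ) (s : ℝ), HasDerivAt (fun s => F (s + v)) (deriv F (s + v)) s := fun v s =>
    (hF.differentiable (s + v)).hasDerivAt.comp_add_const s v
  have hd' := fun s => (hd u s).sub (hd u' s)
  have h := abs_sub_le_of_abs_deriv_le (f := fun s => F (s + u) - F (s + u'))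
    (M := (⨆ x, |deriv (deriv F) x|) * |u - u'|)
    (fun s => (hd' s).differentiableAt) (fun s => ?_) z 0
  · rw [sub_zero] at h
    refine (le_of_eq ?_).trans h
    congr 1; simp only [zero_add]; ring
  · rw [show deriv (fun s => F (s + u) - F (s + u')) s = _ from (hd' s).deriv]
    refine (hF.abs_deriv_sub_le _ _).trans_eq ?_
    rw [add_sub_add_left_eq_sub]

end Gain

/-! ### Regularity of the wave profile -/

section Wave

variable {w F U : ℝ → ℝ} {c : ℝ}

theorem IsTravellingWave.integral_deriv_sub (hU : IsTravellingWave w F c U) (x a b : ℝ) :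
    ∫ s in a..b, deriv U (x - s) = U (x - a) - U (x - b) := by
  have h := intervalIntegral.integral_eq_sub_of_hasDerivAt (a := a) (b := b)
    (f := fun s => -U (x - s)) (f' := fun s => deriv U (x - s))
    (fun s _ => by
      simpa using! (((hU.differentiable (x - s)).hasDerivAt.comp_const_sub x s)).neg)
    (hU.integrable_deriv.comp_sub_left x).intervalIntegrable
  rw [h]; ring

theorem IsTravellingWave.enorm_sub_le (hU : IsTravellingWave w F c U) (x a b : ℝ) :
    ‖U (x - a) - U (x - b)‖ₑ ≤ ∫⁻ s in uIoc a b, ‖deriv U (x - s)‖ₑ := by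
  rw [← hU.integral_deriv_sub, ← ofReal_norm, intervalIntegral.norm_intervalIntegral_eq, ofReal_norm]
  exact enorm_integral_le_lintegral_enorm _

/-- Translation is Lipschitz in `L¹` on a function with integrable gradient: integrate the gradient
over the shift and use Tonelli. -/
theorem IsTravellingWave.lintegral_sub_le (hU : IsTravellingWave w F c U) (a b : ℝ) :
    ∫⁻ x, ‖U (x - a) - U (x - b)‖ₑ ≤
      ENNReal.ofReal |b - a| * ∫⁻ x, ‖deriv U x‖ₑ := by
  have hm : Measurable fun p : ℝ × ℝ => ‖deriv U (p.1 - p.2)‖ₑ :=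
    ((measurable_deriv U).comp (measurable_fst.sub measurable_snd)).enorm
  calc ∫⁻ x, ‖U (x - a) - U (x - b)‖ₑ
      ≤ ∫⁻ x, ∫⁻ s in uIoc a b, ‖deriv U (x - s)‖ₑ := lintegral_mono fun x => hU.enorm_sub_le x a b
    _ = ∫⁻ s in uIoc a b, ∫⁻ x, ‖deriv U (x - s)‖ₑ := lintegral_lintegral_swap hm.aemeasurable
    _ = ENNReal.ofReal |b - a| * ∫⁻ x, ‖deriv U x‖ₑ := by
      simp_rw [lintegral_sub_right_eq_self (fun x => ‖deriv U x‖ₑ)]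
      rw [setLIntegral_const, uIoc, Real.volume_Ioc, mul_comm, max_sub_min_eq_abs]

theorem IsTravellingWave.integrable_sub (hU : IsTravellingWave w F c U) (a b : ℝ) :
    Integrable fun x => U (x - a) - U (x - b) := by
  refine ⟨?_, (hU.lintegral_sub_le a b).trans_lt
    (ENNReal.mul_lt_top ENNReal.ofReal_lt_top hU.integrable_deriv.2)⟩
  have h := hU.differentiable.continuous
  exact Continuous.aestronglyMeasurable (by fun_prop)

theorem IsTravellingWave.integral_abs_sub_le (hU : IsTravellingWave w F c U) (a b : ℝ) :
    ∫ x, |U (x - a) - U (x - b)| ≤ |b - a| * ∫ x, |deriv U x| := by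
  have h := ENNReal.toReal_mono (ENNReal.mul_ne_top ENNReal.ofReal_ne_top
    hU.integrable_deriv.2.ne) (hU.lintegral_sub_le a b)
  rw [ENNReal.toReal_mul, ENNReal.toReal_ofReal (abs_nonneg _),
    ← integral_norm_eq_lintegral_enorm hU.integrable_deriv.1,
    ← integral_norm_eq_lintegral_enorm (hU.integrable_sub a b).1] at h
  exact h

theorem IsTravellingWave.exists_bound (hU : IsTravellingWave w F c U) : ∃ B, ∀ x, |U x| ≤ B := by
  refine ⟨|U 0| + ∫ x, |deriv U x|, fun x => ?_⟩
  have h := intervalIntegral.integral_eq_sub_of_hasDerivAt (a := 0) (b := x)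
    (fun s _ => (hU.differentiable s).hasDerivAt) hU.integrable_deriv.intervalIntegrable
  have h1 : |U x - U 0| ≤ ∫ x, |deriv U x| := by
    rw [← h, ← Real.norm_eq_abs, intervalIntegral.norm_intervalIntegral_eq]
    exact (norm_integral_le_integral_norm _).trans (setIntegral_le_integral
      hU.integrable_deriv.norm (ae_of_all _ fun x => norm_nonneg _))
  have h2 := abs_sub_abs_le_abs_sub (U x) (U 0)
  linarith

theorem IsTravellingWave.exists_bound_comp (hU : IsTravellingWave w F c U) (hF : IsGain F) :
    ∃ B, ∀ x, |F (U x)| ≤ B := by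
  obtain ⟨B, hB⟩ := hU.exists_bound
  obtain ⟨D, hD⟩ := (isCompact_Icc (a := -B) (b := B)).exists_bound_of_continuousOn
    hF.differentiable.continuous.continuousOn
  exact ⟨D, fun x => hD _ (abs_le.1 (hB x))⟩

/-- Move the shift onto `U`: `w` is bounded, `F` is Lipschitz, and translates of `U` are Lipschitz
in `L¹`. This serves the standing front `c = 0`. -/
theorem abs_convolution_sub_le (hw : IsKernel w) (hF : IsGain F)
    (hU : IsTravellingWave w F c U) : ∃ L, ∀ x y,
    |(w ⋆ fun y => F (U y)) x - (w ⋆ fun y => F (U y)) y| ≤ L * |x - y| := by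
  obtain ⟨M, hM⟩ := hw.bounded
  obtain ⟨D, hD⟩ := hF.bounded_deriv
  obtain ⟨B, hB⟩ := hU.exists_bound_comp hF
  have hM0 : 0 ≤ M := (hw.nonneg 0).trans (hM 0)
  have hD0 : 0 ≤ D := (abs_nonneg _).trans (hD 0)
  have hc := hF.differentiable.continuous.comp hU.differentiable.continuous
  refine ⟨M * D * ∫ x, |deriv U x|, fun x y => ?_⟩
  have hex : ∀ x, Integrable fun t => w t • F (U (x - t)) :=
    hw.convolutionExistsAt_of_bounded hc.aestronglyMeasurable hB
  have hi : Integrable fun t => |U (x - t) - U (y - t)| := by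
    have := ((hU.integrable_sub 0 (x - y)).comp_sub_left x).abs
    refine this.congr (ae_of_all _ fun t => ?_)
    simp
  have he : ∫ t, |U (x - t) - U (y - t)| = ∫ t, |U (t - 0) - U (t - (x - y))| := by
    rw [← integral_sub_left_eq_self (fun t => |U (t - 0) - U (t - (x - y))|) volume x]
    refine integral_congr_ae (ae_of_all _ fun t => ?_)
    simp
  rw [convolution_lsmul, convolution_lsmul, ← integral_sub (hex x) (hex y), ← Real.norm_eq_abs]
  refine (norm_integral_le_of_norm_le (hi.const_mul (M * D)) (ae_of_all _ fun t => ?_)).trans ?_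
  · rw [smul_eq_mul, smul_eq_mul, ← mul_sub, norm_mul, mul_assoc,
      Real.norm_of_nonneg (hw.nonneg t)]
    exact mul_le_mul (hM t) (abs_sub_le_of_abs_deriv_le hF.differentiable hD _ _) (norm_nonneg _)
      hM0
  · rw [integral_const_mul, he, mul_assoc (M * D)]
    refine mul_le_mul_of_nonneg_left ?_ (mul_nonneg hM0 hD0)
    refine (hU.integral_abs_sub_le 0 (x - y)).trans_eq ?_
    rw [sub_zero, mul_comm]

/-- For `c ≠ 0` the wave equation can be solved for `U'`. For `c = 0` it reads `U = w ∗ F(U)`, and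
the right-hand side is Lipschitz. -/
theorem IsTravellingWave.exists_bound_deriv (hw : IsKernel w) (hF : IsGain F)
    (hU : IsTravellingWave w F c U) : ∃ B, ∀ x, |deriv U x| ≤ B := by
  rcases eq_or_ne c 0 with rfl | hc
  · obtain ⟨L, hL⟩ := abs_convolution_sub_le hw hF hU
    have hL0 : 0 ≤ L := by simpa using (abs_nonneg _).trans (hL 1 0)
    have hUe : U = w ⋆ fun y => F (U y) := by
      funext x
      have := hU.equation x
      linarith
    refine ⟨L, fun x => ?_⟩
    have hLip : LipschitzWith ⟨L, hL0⟩ U := LipschitzWith.of_dist_le_mul fun x y => by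
      rw [Real.dist_eq, Real.dist_eq, hUe]; exact hL x y
    exact norm_deriv_le_of_lipschitz hLip
  · obtain ⟨B, hB⟩ := hU.exists_bound
    obtain ⟨D, hD⟩ := hU.exists_bound_comp hF
    refine ⟨|c|⁻¹ * (B + D), fun x => ?_⟩
    have hconv : |(w ⋆ fun y => F (U y)) x| ≤ D := by
      rw [convolution_lsmul, ← Real.norm_eq_abs]
      refine (norm_integral_le_of_norm_le (hw.integrable.mul_const D)
        (ae_of_all _ fun t => ?_)).trans_eq ?_
      · rw [norm_smul, Real.norm_of_nonneg (hw.nonneg t)]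
        exact mul_le_mul_of_nonneg_left (hD _) (hw.nonneg t)
      · rw [integral_mul_const, hw.integral_eq_one, one_mul]
    have he := hU.equation x
    have habs : |c| * |deriv U x| ≤ B + D := by
      rw [← abs_mul, ← abs_neg, ← neg_mul, he]
      refine (abs_add_le _ _).trans (add_le_add ?_ hconv)
      rw [abs_neg]; exact hB x
    rw [← div_eq_inv_mul, le_div_iff₀ (abs_pos.2 hc), mul_comm]
    exact habs

theorem IsTravellingWave.memLp_deriv (hw : IsKernel w) (hF : IsGain F)
    (hU : IsTravellingWave w F c U) : MemLp (deriv U) 2 := by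
  obtain ⟨B, hB⟩ := hU.exists_bound_deriv hw hF
  exact memLp_two_of_integrable_of_bounded hU.integrable_deriv hB

theorem IsTravellingWave.memLp_sub (hU : IsTravellingWave w F c U) (a b : ℝ) :
    MemLp (fun x => U (x - a) - U (x - b)) 2 := by
  obtain ⟨B, hB⟩ := hU.exists_bound
  refine memLp_two_of_integrable_of_bounded (hU.integrable_sub a b) (M := B + B) fun x => ?_
  exact (abs_sub _ _).trans (add_le_add (hB _) (hB _))

/-! ### Translations of the wave profile -/

theorem continuous_gradWave (hU : MemLp (deriv U) 2) : Continuous (gradWave U) := by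
  have h := Continuous.compMeasurePreservingLp (Z := ℝ) (X := ℝ) (Y := ℝ) (E := ℝ) (p := 2)
    (μ := volume) (ν := volume) (f := fun _ => hU.toLp (deriv U))
    (g := fun a => ⟨fun x => x - a, by fun_prop⟩) continuous_const
    (ContinuousMap.continuous_of_continuous_uncurry _ (by
      change Continuous fun p : ℝ × ℝ => p.2 - p.1
      fun_prop))
    (fun a => measurePreserving_sub_right volume a) (by norm_num)
  refine h.congr fun a => ?_
  rw [gradWave, toL2_of_memLp (memLp_comp_sub hU a)]
  rfl

theorem norm_gradWave (hU : MemLp (deriv U) 2) (a : ℝ) : ‖gradWave U a‖ = ‖toL2 (deriv U)‖ := by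
  rw [gradWave, norm_toL2 (memLp_comp_sub hU a), norm_toL2 hU]
  congr 1
  exact eLpNorm_comp_measurePreserving (g := deriv U) hU.1 (measurePreserving_sub_right volume a)

/-- Tested against `h ∈ L²`, this is Fubini and the pointwise fundamental theorem of calculus. -/
theorem integral_gradWave (hU : IsTravellingWave w F c U) (hU2 : MemLp (deriv U) 2) (a b : ℝ) :
    ∫ s in a..b, gradWave U s = toL2 fun x => U (x - a) - U (x - b) := by
  refine ext_inner_left ℝ fun h => ?_
  have hint : IntervalIntegrable (gradWave U) volume a b :=
    (continuous_gradWave hU2).intervalIntegrable a b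
  have hprod : Integrable (fun p : ℝ × ℝ => h p.2 * deriv U (p.2 - p.1))
      ((volume.restrict (uIoc a b)).prod volume) := by
    have hm : AEStronglyMeasurable (fun p : ℝ × ℝ => h p.2 * deriv U (p.2 - p.1))
        ((volume.restrict (uIoc a b)).prod volume) :=
      (Lp.memLp h).1.comp_snd.mul
        ((measurable_deriv U).comp (measurable_snd.sub measurable_fst)).aestronglyMeasurable
    rw [integrable_prod_iff hm]
    refine ⟨ae_of_all _ fun s => (Lp.memLp h).integrable_mul (memLp_comp_sub hU2 s), ?_⟩
    have : IsFiniteMeasure (volume.restrict (uIoc a b)) :=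
      ⟨by rw [Measure.restrict_apply_univ, uIoc]; exact measure_Ioc_lt_top⟩
    -- `|h U'(· - s)| ≤ h² + U'(· - s)²`, whose integral does not depend on `s` by translation
    -- invariance.
    refine (integrable_const ((∫ x, (h x) ^ 2) + ∫ x, (deriv U x) ^ 2)).mono'
      hm.norm.integral_prod_right' (ae_of_all _ fun s => ?_)
    have h1 : Integrable fun x => (h x) ^ 2 := (Lp.memLp h).integrable_sq
    have h2 : Integrable fun x => (deriv U (x - s)) ^ 2 := (memLp_comp_sub hU2 s).integrable_sq
    rw [Real.norm_of_nonneg (integral_nonneg fun _ => norm_nonneg _),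
      ← integral_sub_right_eq_self (fun x => deriv U x ^ 2) s, ← integral_add h1 h2]
    refine integral_mono ((Lp.memLp h).integrable_mul (memLp_comp_sub hU2 s)).norm (h1.add h2)
      fun x => ?_
    simp only [norm_mul, Real.norm_eq_abs]
    nlinarith [sq_abs (h x), sq_abs (deriv U (x - s)), sq_nonneg (|h x| - |deriv U (x - s)|),
      sq_nonneg (|h x|), sq_nonneg (|deriv U (x - s)|)]
  calc inner ℝ h (∫ s in a..b, gradWave U s)
      = ∫ s in a..b, inner ℝ h (gradWave U s) :=
        ((innerSL ℝ h).intervalIntegral_comp_comm hint).symm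
    _ = ∫ s in a..b, ∫ x, h x * deriv U (x - s) := by
        simp_rw [gradWave, inner_toL2 h (memLp_comp_sub hU2 _)]
    _ = ∫ x, ∫ s in a..b, h x * deriv U (x - s) := by
        simp_rw [intervalIntegral.intervalIntegral_eq_integral_uIoc]
        rw [integral_smul, integral_integral_swap hprod]
    _ = ∫ x, h x * (U (x - a) - U (x - b)) := by
        simp_rw [intervalIntegral.integral_const_mul, hU.integral_deriv_sub]
    _ = _ := (inner_toL2 h (hU.memLp_sub a b)).symm

theorem hasDerivAt_toL2_sub (hU : IsTravellingWave w F c U) (hU2 : MemLp (deriv U) 2) (a : ℝ) :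
    HasDerivAt (fun b => toL2 fun x => U x - U (x - b)) (gradWave U a) a := by
  have h := (continuous_gradWave hU2).integral_hasStrictDerivAt 0 a
  refine h.hasDerivAt.congr_of_eventuallyEq (Eventually.of_forall fun b => ?_)
  simp only [integral_gradWave hU hU2, sub_zero]

end Wave

/-! ### Continuity and bounds for the drift and the linearized operators -/

theorem norm_toL2_sub_le {f g : ℝ → ℝ} (hf : MemLp f 2) (hg : MemLp g 2) {y z : L2R} {r s : ℝ}
    (hr : 0 ≤ r) (hs : 0 ≤ s) (h : ∀ᵐ x, |f x - g x| ≤ r * |(y - z) x| + s * |z x|) :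
    ‖toL2 f - toL2 g‖ ≤ r * ‖y - z‖ + s * ‖z‖ := by
  have h1 : MemLp (fun x => r * |(y - z) x|) 2 := (Lp.memLp (y - z)).abs.const_mul r
  have h2 : MemLp (fun x => s * |z x|) 2 := (Lp.memLp z).abs.const_mul s
  calc ‖toL2 f - toL2 g‖ = ‖toL2 fun x => f x - g x‖ := by rw [toL2_sub hf hg]
    _ ≤ ‖toL2 fun x => r * |(y - z) x| + s * |z x|‖ := by
      refine Lp.norm_le_norm_of_ae_le ?_
      filter_upwards [coeFn_toL2 (hf.sub hg), coeFn_toL2 (h1.add h2), h] with x e1 e2 hx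
      change ‖(toL2 (f - g)) x‖ ≤ ‖(toL2 ((fun x => r * |(y - z) x|) + fun x => s * |z x|)) x‖
      rw [e1, e2]
      exact hx.trans (le_abs_self _)
    _ ≤ ‖toL2 fun x => r * |(y - z) x|‖ + ‖toL2 fun x => s * |z x|‖ := by
      rw [toL2_add h1 h2]; exact norm_add_le _ _
    _ ≤ r * ‖y - z‖ + s * ‖z‖ := by
      refine add_le_add (norm_toL2_le_mul_norm h1 (ae_of_all _ fun x => ?_))
        (norm_toL2_le_mul_norm h2 (ae_of_all _ fun x => ?_))
      · rw [abs_mul, abs_abs, abs_of_nonneg hr]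
      · rw [abs_mul, abs_abs, abs_of_nonneg hs]

/-- The Lipschitz constant in the parameter may grow with `‖z‖`, because `z` is held fixed at the
limit point. -/
theorem continuous_of_norm_sub_le {E : Type*} [NormedAddCommGroup E] {N : ℝ → E → E} {r s : ℝ}
    (h : ∀ a b y z, ‖N a y - N b z‖ ≤ r * ‖y - z‖ + s * |a - b| * ‖z‖) :
    Continuous fun p : ℝ × E => N p.1 p.2 := by
  refine continuous_iff_continuousAt.2 fun q => tendsto_iff_norm_sub_tendsto_zero.2 ?_
  refine squeeze_zero (fun _ => norm_nonneg _) (fun p => h p.1 q.1 p.2 q.2) ?_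
  have hc : Continuous fun p : ℝ × E => r * ‖p.2 - q.2‖ + s * |p.1 - q.1| * ‖q.2‖ := by fun_prop
  simpa using hc.tendsto q

section Operators

variable {w F U : ℝ → ℝ} {c : ℝ}

theorem IsTravellingWave.aestronglyMeasurable_comp_sub (hU : IsTravellingWave w F c U) (a : ℝ) :
    AEStronglyMeasurable fun y => U (y - a) :=
  (hU.differentiable.continuous.comp (continuous_id.sub continuous_const)).aestronglyMeasurable

theorem memLp_deriv_gain_mul (hF : IsGain F) (hU : IsTravellingWave w F c U) (a : ℝ) (z : L2R) :
    MemLp (fun y => deriv F (U (y - a)) * z y) 2 := by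
  obtain ⟨D, hD⟩ := hF.bounded_deriv
  refine (Lp.memLp z).of_le_mul (c := D) ?_ (ae_of_all _ fun x => ?_)
  · exact (hF.contDiff_deriv.continuous.comp_aestronglyMeasurable
      (hU.aestronglyMeasurable_comp_sub a)).mul (Lp.memLp z).1
  · rw [norm_mul]
    exact mul_le_mul_of_nonneg_right (hD _) (norm_nonneg _)

theorem memLp_gain_increment (hF : IsGain F) (hU : IsTravellingWave w F c U) (a : ℝ) (z : L2R) :
    MemLp (fun y => F (z y + U (y - a)) - F (U (y - a))) 2 := by
  obtain ⟨D, hD⟩ := hF.bounded_deriv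
  refine (Lp.memLp z).of_le_mul (c := D) ?_ (ae_of_all _ fun x => ?_)
  · have h1 := hU.aestronglyMeasurable_comp_sub a
    have hc := hF.differentiable.continuous
    exact (hc.comp_aestronglyMeasurable ((Lp.memLp z).1.add h1)).sub
      (hc.comp_aestronglyMeasurable h1)
  · simpa using abs_sub_le_of_abs_deriv_le hF.differentiable hD (z x + U (x - a)) (U (x - a))

theorem memLp_gain_sub (hF : IsGain F) (hU : IsTravellingWave w F c U) (a b : ℝ) :
    MemLp (fun y => F (U (y - a)) - F (U (y - b))) 2 := by
  obtain ⟨D, hD⟩ := hF.bounded_deriv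
  refine (hU.memLp_sub a b).of_le_mul (c := D) ?_ (ae_of_all _ fun x => ?_)
  · have hc := hF.differentiable.continuous
    exact (hc.comp_aestronglyMeasurable (hU.aestronglyMeasurable_comp_sub a)).sub
      (hc.comp_aestronglyMeasurable (hU.aestronglyMeasurable_comp_sub b))
  · exact abs_sub_le_of_abs_deriv_le hF.differentiable hD _ _

theorem opA0_eq (hw : IsKernel w) (hF : IsGain F) (hU : IsTravellingWave w F c U) (a : ℝ)
    (z : L2R) :
    opA0 w F U a z = -z + convCLM hw (toL2 fun y => deriv F (U (y - a)) * z y) := by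
  rw [opA0, toL2_convolution hw (memLp_deriv_gain_mul hF hU a z)]

theorem driftV_eq (hw : IsKernel w) (hF : IsGain F) (hU : IsTravellingWave w F c U) (t : ℝ)
    (v : L2R) : driftV w F U c t v =
      -v + convCLM hw (toL2 fun y => F (v y + U (y - c * t)) - F (U (y - c * t))) := by
  rw [driftV, toL2_convolution hw (memLp_gain_increment hF hU (c * t) v)]

theorem continuous_opA0 (hw : IsKernel w) (hF : IsGain F) (hU : IsTravellingWave w F c U) :
    Continuous fun p : ℝ × L2R => opA0 w F U p.1 p.2 := by
  obtain ⟨D, hD⟩ := hF.bounded_deriv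
  obtain ⟨B, hB⟩ := hU.exists_bound_deriv hw hF
  have hD0 : 0 ≤ D := (abs_nonneg _).trans (hD 0)
  have hB0 : 0 ≤ B := (abs_nonneg _).trans (hB 0)
  have hG0 := (abs_nonneg _).trans (hF.abs_deriv2_le 0)
  simp_rw [opA0_eq hw hF hU]
  refine continuous_snd.neg.add ((convCLM hw).continuous.comp ?_)
  refine continuous_of_norm_sub_le (N := fun a z => toL2 fun y => deriv F (U (y - a)) * z y)
    (r := D) (s := (⨆ x, |deriv (deriv F) x|) * B) fun a b y z => ?_
  refine norm_toL2_sub_le (memLp_deriv_gain_mul hF hU a y) (memLp_deriv_gain_mul hF hU b z) hD0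
    (by positivity) ?_
  filter_upwards [Lp.coeFn_sub y z] with x hx
  rw [hx, Pi.sub_apply]
  have e : deriv F (U (x - a)) * y x - deriv F (U (x - b)) * z x =
      deriv F (U (x - a)) * (y x - z x) + (deriv F (U (x - a)) - deriv F (U (x - b))) * z x := by
    ring
  rw [e]
  refine (abs_add_le _ _).trans (add_le_add ?_ ?_)
  · rw [abs_mul]
    exact mul_le_mul_of_nonneg_right (hD _) (abs_nonneg _)
  · rw [abs_mul]
    refine mul_le_mul_of_nonneg_right ((hF.abs_deriv_sub_le _ _).trans ?_) (abs_nonneg _)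
    rw [mul_assoc]
    refine mul_le_mul_of_nonneg_left ?_ hG0
    refine (abs_sub_le_of_abs_deriv_le hU.differentiable hB _ _).trans_eq ?_
    rw [sub_sub_sub_cancel_left, abs_sub_comm]

theorem continuous_driftV (hw : IsKernel w) (hF : IsGain F) (hU : IsTravellingWave w F c U) :
    Continuous fun p : ℝ × L2R => driftV w F U c p.1 p.2 := by
  obtain ⟨D, hD⟩ := hF.bounded_deriv
  obtain ⟨B, hB⟩ := hU.exists_bound_deriv hw hF
  have hD0 : 0 ≤ D := (abs_nonneg _).trans (hD 0)
  have hB0 : 0 ≤ B := (abs_nonneg _).trans (hB 0)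
  have hG0 := (abs_nonneg _).trans (hF.abs_deriv2_le 0)
  simp_rw [driftV_eq hw hF hU]
  refine continuous_snd.neg.add ((convCLM hw).continuous.comp ?_)
  have hN : Continuous fun p : ℝ × L2R =>
      toL2 fun y => F (p.2 y + U (y - p.1)) - F (U (y - p.1)) := by
    refine continuous_of_norm_sub_le
      (N := fun a z => toL2 fun y => F (z y + U (y - a)) - F (U (y - a)))
      (r := D) (s := (⨆ x, |deriv (deriv F) x|) * B) fun a b y z => ?_
    refine norm_toL2_sub_le (memLp_gain_increment hF hU a y) (memLp_gain_increment hF hU b z) hD0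
      (by positivity) ?_
    filter_upwards [Lp.coeFn_sub y z] with x hx
    rw [hx, Pi.sub_apply]
    have e : F (y x + U (x - a)) - F (U (x - a)) - (F (z x + U (x - b)) - F (U (x - b))) =
        (F (y x + U (x - a)) - F (z x + U (x - a))) +
        ((F (z x + U (x - a)) - F (U (x - a))) - (F (z x + U (x - b)) - F (U (x - b)))) := by
      ring
    rw [e]
    refine (abs_add_le _ _).trans (add_le_add ?_ ?_)
    · refine (abs_sub_le_of_abs_deriv_le hF.differentiable hD _ _).trans_eq ?_
      rw [add_sub_add_right_eq_sub]
    · refine (hF.abs_increment_sub_le _ _ _).trans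
        (mul_le_mul_of_nonneg_right ?_ (abs_nonneg _))
      rw [mul_assoc]
      refine mul_le_mul_of_nonneg_left ?_ hG0
      refine (abs_sub_le_of_abs_deriv_le hU.differentiable hB _ _).trans_eq ?_
      rw [sub_sub_sub_cancel_left, abs_sub_comm]
  exact hN.comp ((continuous_const.mul continuous_fst).prodMk continuous_snd)

theorem continuous_opA (hw : IsKernel w) (hF : IsGain F) (hU : IsTravellingWave w F c U) (m : ℝ) :
    Continuous fun p : ℝ × L2R => opA w F U m p.1 p.2 := by
  have hg : Continuous fun p : ℝ × L2R => gradWave U p.1 :=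
    (continuous_gradWave (hU.memLp_deriv hw hF)).comp continuous_fst
  have hi : Continuous fun p : ℝ × L2R => inner ℝ (gradWave U p.1) p.2 := hg.inner continuous_snd
  exact (continuous_opA0 hw hF hU).sub ((hi.const_mul m).smul hg)

theorem opA_add (hw : IsKernel w) (hF : IsGain F) (hU : IsTravellingWave w F c U) (m a : ℝ)
    (y z : L2R) : opA w F U m a (y + z) = opA w F U m a y + opA w F U m a z := by
  have e : (toL2 fun x => deriv F (U (x - a)) * (y + z) x) =
      (toL2 fun x => deriv F (U (x - a)) * y x) + toL2 fun x => deriv F (U (x - a)) * z x := by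
    rw [← toL2_add (memLp_deriv_gain_mul hF hU a y) (memLp_deriv_gain_mul hF hU a z)]
    refine toL2_congr ?_
    filter_upwards [Lp.coeFn_add y z] with x hx
    rw [hx, Pi.add_apply, mul_add]
  simp only [opA, opA0_eq hw hF hU, e, map_add, inner_add_right, mul_add, add_smul]
  abel

theorem opA_smul (hw : IsKernel w) (hF : IsGain F) (hU : IsTravellingWave w F c U) (m a r : ℝ)
    (z : L2R) : opA w F U m a (r • z) = r • opA w F U m a z := by
  have e : (toL2 fun x => deriv F (U (x - a)) * (r • z) x) =
      r • toL2 fun x => deriv F (U (x - a)) * z x := by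
    rw [← toL2_const_mul (memLp_deriv_gain_mul hF hU a z)]
    refine toL2_congr ?_
    filter_upwards [Lp.coeFn_smul r z] with x hx
    rw [hx, Pi.smul_apply, smul_eq_mul]; ring
  simp only [opA, opA0_eq hw hF hU, e, map_smul, inner_smul_right, smul_sub, smul_add, smul_neg,
    smul_smul]
  congr 2
  ring

theorem opA_sub (hw : IsKernel w) (hF : IsGain F) (hU : IsTravellingWave w F c U) (m a : ℝ)
    (y z : L2R) : opA w F U m a (y - z) = opA w F U m a y - opA w F U m a z := by
  rw [eq_sub_iff_add_eq, ← opA_add hw hF hU, sub_add_cancel]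

/-- The bound is uniform in `a`, since translation preserves `‖U'‖`. Estimates for `Z` therefore
depend neither on the random phase nor on `ε`. -/
theorem exists_norm_opA_le (hw : IsKernel w) (hF : IsGain F) (hU : IsTravellingWave w F c U)
    (m : ℝ) : ∃ L, 0 ≤ L ∧ ∀ a z, ‖opA w F U m a z‖ ≤ L * ‖z‖ := by
  obtain ⟨D, hD⟩ := hF.bounded_deriv
  have hD0 : 0 ≤ D := (abs_nonneg _).trans (hD 0)
  have hU2 := hU.memLp_deriv hw hF
  refine ⟨1 + D + |m| * ‖toL2 (deriv U)‖ * ‖toL2 (deriv U)‖, by positivity, fun a z => ?_⟩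
  rw [opA, opA0_eq hw hF hU]
  refine (norm_sub_le _ _).trans ?_
  rw [add_mul, add_mul]
  refine add_le_add ((norm_add_le _ _).trans (add_le_add ?_ ?_)) ?_
  · rw [norm_neg, one_mul]
  · refine (norm_convCLM_le hw _).trans (norm_toL2_le_mul_norm (memLp_deriv_gain_mul hF hU a z)
      (ae_of_all _ fun x => ?_))
    rw [abs_mul]
    exact mul_le_mul_of_nonneg_right (hD _) (abs_nonneg _)
  · rw [norm_smul, norm_mul, Real.norm_eq_abs m, norm_gradWave hU2]
    have := norm_inner_le_norm (𝕜 := ℝ) (gradWave U a) z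
    rw [norm_gradWave hU2] at this
    calc |m| * ‖inner ℝ (gradWave U a) z‖ * ‖toL2 (deriv U)‖
        ≤ |m| * (‖toL2 (deriv U)‖ * ‖z‖) * ‖toL2 (deriv U)‖ := by gcongr
      _ = _ := by ring

/-- The rank-one term contributes `-m ⟨U'(· - a), z⟩²`, which absorbs the `Cs` term of the spectral
gap. -/
theorem inner_opA_nonpos {κ Cs m : ℝ} (hκ : 0 < κ) (hgap : SpectralGap w F U κ Cs) (hm : Cs < m)
    (a : ℝ) (z : L2R) : inner ℝ (opA w F U m a z) z ≤ 0 := by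
  have h := hgap a z
  rw [opA, inner_sub_left, inner_smul_left]
  simp only [conj_trivial]
  nlinarith [mul_nonneg hκ.le (sq_nonneg ‖z‖),
    mul_nonneg (sub_pos.2 hm).le (sq_nonneg (inner ℝ (gradWave U a) z))]

/-! ### The remainder of the linearization -/

/-- The quadratic remainder `w ∗ (F(z + U(· - a)) - F(U(· - a)) - F'(U(· - a)) z)`. -/
noncomputable def quadRemainder (hw : IsKernel w) (F U : ℝ → ℝ) (a : ℝ) (z : L2R) : L2R :=
  convCLM hw (toL2 fun y => F (z y + U (y - a)) - F (U (y - a)) - deriv F (U (y - a)) * z y)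

theorem remainderConst_nonneg (w F : ℝ → ℝ) : 0 ≤ remainderConst w F := by
  have := Real.iSup_nonneg fun x => abs_nonneg (deriv (deriv F) x)
  unfold remainderConst
  positivity

/-- The pointwise Taylor bound is quadratic in `z`, hence only in `L¹`; the smoothing of `w` from
`L¹` to `L²` makes up for it. -/
theorem norm_quadRemainder_le (hw : IsKernel w) (hF : IsGain F) (hU : IsTravellingWave w F c U)
    (a : ℝ) (z : L2R) : ‖quadRemainder hw F U a z‖ ≤ remainderConst w F * ‖z‖ ^ 2 := by
  have hm := (memLp_gain_increment hF hU a z).sub (memLp_deriv_gain_mul hF hU a z)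
  have hz : Integrable fun x => (z x) ^ 2 := (Lp.memLp z).integrable_sq
  have hb : ∀ x, |F (z x + U (x - a)) - F (U (x - a)) - deriv F (U (x - a)) * z x| ≤
      1 / 2 * (⨆ x, |deriv (deriv F) x|) * (z x) ^ 2 := fun x => hF.abs_taylor_le _ _
  have hi := (hz.const_mul (1 / 2 * (⨆ x, |deriv (deriv F) x|))).mono' hm.1 (ae_of_all _ hb)
  refine (norm_convCLM_toL2_le hw hm hi).trans ?_
  have e : ∫ x, (z x) ^ 2 = ‖z‖ ^ 2 := by
    rw [← real_inner_self_eq_norm_sq, L2.inner_def]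
    simp [sq]
  rw [remainderConst, mul_comm (1 / 2 * _), mul_assoc]
  refine mul_le_mul_of_nonneg_left ?_ (Real.sqrt_nonneg _)
  rw [← e, ← integral_const_mul]
  exact integral_mono hi.abs (hz.const_mul _) hb

/-- The difference of the wave equations at two translates. Each equation alone has terms outside
`L²`; the difference makes sense there. -/
theorem smul_gradWave_sub (hw : IsKernel w) (hF : IsGain F) (hU : IsTravellingWave w F c U)
    (a b : ℝ) : c • gradWave U b - c • gradWave U a =
      convCLM hw (toL2 fun y => F (U (y - a)) - F (U (y - b))) -
        toL2 (fun x => U (x - a) - U (x - b)) := by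
  have hU2 := hU.memLp_deriv hw hF
  obtain ⟨B, hB⟩ := hU.exists_bound_comp hF
  have hc := hF.differentiable.continuous.comp hU.differentiable.continuous
  have hex : ∀ x, Integrable fun t => w t • F (U (x - t)) :=
    hw.convolutionExistsAt_of_bounded hc.aestronglyMeasurable hB
  have hFU := memLp_gain_sub hF hU a b
  rw [← toL2_convolution hw hFU, ← toL2_sub (memLp_convolution hw.integrable hFU)
    (hU.memLp_sub a b), gradWave, gradWave, ← toL2_const_mul (memLp_comp_sub hU2 a),
    ← toL2_const_mul (memLp_comp_sub hU2 b), ← toL2_sub ((memLp_comp_sub hU2 b).const_mul c)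
    ((memLp_comp_sub hU2 a).const_mul c)]
  congr 1
  funext x
  have e : (w ⋆ fun y => F (U (y - a)) - F (U (y - b))) x =
      (w ⋆ fun y => F (U y)) (x - a) - (w ⋆ fun y => F (U y)) (x - b) := by
    rw [convolution_lsmul, convolution_lsmul, convolution_lsmul,
      ← integral_sub (hex (x - a)) (hex (x - b))]
    refine integral_congr_ae (ae_of_all _ fun t => ?_)
    simp only [smul_sub, sub_right_comm x t]
  have h1 := hU.equation (x - a)
  have h2 := hU.equation (x - b)
  rw [e]
  linarith

theorem fluctuation_eq (hU : IsTravellingWave w F c U) (t : ℝ) (v : L2R) (C : ℝ) :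
    fluctuation U c t v C = v + toL2 fun x => U (x - c * t) - U (x - (c * t + C)) := by
  nth_rw 2 [← toL2_coe v]
  rw [← toL2_add (Lp.memLp v) (hU.memLp_sub _ _), fluctuation]
  congr 1
  funext x
  simp only [field, sub_sub]
  ring

theorem toL2_sub_translate (hU : IsTravellingWave w F c U) (a b : ℝ) :
    (toL2 fun x => U (x - a) - U (x - b)) =
      (toL2 fun x => U x - U (x - b)) - toL2 fun x => U x - U (x - a) := by
  have h0 : ∀ b, MemLp (fun x => U x - U (x - b)) 2 := fun b => by
    simpa using hU.memLp_sub 0 b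
  rw [← toL2_sub (h0 b) (h0 a)]
  congr 1
  funext x
  ring

/-- The left side is the drift of `v` plus the velocity `(c + C') U'(· - ct - C) - c U'(· - ct)` of
the front difference. The increments of `F` telescope to one increment around the shifted front,
which splits into its linear part and the quadratic remainder. -/
theorem driftV_add_eq (hw : IsKernel w) (hF : IsGain F) (hU : IsTravellingWave w F c U)
    (m t : ℝ) (v : L2R) (C : ℝ) :
    driftV w F U c t v + ((c + -m * inner ℝ (gradWave U (c * t + C)) (fluctuation U c t v C)) •
      gradWave U (c * t + C) - c • gradWave U (c * t)) =
    opA w F U m (c * t + C) (fluctuation U c t v C) +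
      quadRemainder hw F U (c * t + C) (fluctuation U c t v C) := by
  have hfl := fluctuation_eq hU t v C
  set z := fluctuation U c t v C
  have hz : ∀ᵐ x, z x + U (x - (c * t + C)) = v x + U (x - c * t) := by
    rw [hfl]
    filter_upwards [Lp.coeFn_add v (toL2 fun x => U (x - c * t) - U (x - (c * t + C))),
      coeFn_toL2 (hU.memLp_sub (c * t) (c * t + C))] with x h1 h2
    rw [h1, Pi.add_apply, h2]
    ring
  have e1 : (toL2 fun y => F (v y + U (y - c * t)) - F (U (y - c * t))) +
      (toL2 fun y => F (U (y - c * t)) - F (U (y - (c * t + C)))) =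
      toL2 fun y => F (z y + U (y - (c * t + C))) - F (U (y - (c * t + C))) := by
    rw [← toL2_add (memLp_gain_increment hF hU _ _) (memLp_gain_sub hF hU _ _)]
    refine toL2_congr ?_
    filter_upwards [hz] with x hx
    rw [hx]; ring
  have e2 := smul_gradWave_sub hw hF hU (c * t) (c * t + C)
  have e3 : quadRemainder hw F U (c * t + C) z =
      convCLM hw (toL2 fun y => F (z y + U (y - (c * t + C))) - F (U (y - (c * t + C)))) -
      convCLM hw (toL2 fun y => deriv F (U (y - (c * t + C))) * z y) := by
    rw [quadRemainder, toL2_sub (memLp_gain_increment hF hU _ _) (memLp_deriv_gain_mul hF hU _ _),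
      map_sub]
  rw [eq_sub_of_add_eq' hfl.symm] at e2
  rw [e3, ← e1, map_add, opA, opA0_eq hw hF hU, driftV_eq hw hF hU, add_smul, add_sub_right_comm,
    e2, neg_mul, neg_smul]
  abel

end Operators

/-! ### An energy estimate -/

theorem hasDerivWithinAt_integral_Icc {E : Type*} [NormedAddCommGroup E] [NormedSpace ℝ E]
    [CompleteSpace E] {T : ℝ} {h : ℝ → E} (hh : ContinuousOn h (Icc 0 T)) {t : ℝ}
    (ht : t ∈ Icc 0 T) :
    HasDerivWithinAt (fun t => ∫ s in (0 : ℝ)..t, h s) (h t) (Icc 0 T) t := by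
  have hT : 0 ≤ T := ht.1.trans ht.2
  -- Extend `h` continuously to the line by freezing it outside `[0, T]`, which does not change the
  -- integrals.
  have hc : Continuous fun s => h (projIcc 0 T hT s) :=
    hh.comp_continuous (continuous_subtype_val.comp continuous_projIcc) fun s => (projIcc 0 T hT s).2
  have he : ∀ s ∈ Icc 0 T, h (projIcc 0 T hT s) = h s := fun s hs => by rw [projIcc_of_mem hT hs]
  have hd := (hc.integral_hasStrictDerivAt 0 t).hasDerivAt.hasDerivWithinAt (s := Icc 0 T)
  rw [he t ht] at hd
  refine hd.congr_of_mem (fun s hs => ?_) ht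
  refine intervalIntegral.integral_congr fun r hr => ?_
  rw [uIcc_of_le hs.1] at hr
  exact (he r ⟨hr.1, hr.2.trans hs.2⟩).symm

/-- Formally `‖y‖' ≤ k`. As the norm is not differentiable at `0`, the argument runs for `√(‖y‖² +
δ²)`, which starts at `δ`, and `δ` is arbitrary. -/
theorem norm_le_integral_of_inner_deriv_le {E : Type*} [NormedAddCommGroup E]
    [InnerProductSpace ℝ E] {T : ℝ} {y g : ℝ → E} {k : ℝ → ℝ}
    (hy : ∀ t ∈ Icc 0 T, HasDerivWithinAt y (g t) (Icc 0 T) t) (hy0 : y 0 = 0)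
    (hk : ContinuousOn k (Icc 0 T)) (hk0 : ∀ t ∈ Icc 0 T, 0 ≤ k t)
    (hg : ∀ t ∈ Icc 0 T, inner ℝ (g t) (y t) ≤ k t * ‖y t‖) :
    ∀ t ∈ Icc 0 T, ‖y t‖ ≤ ∫ s in (0 : ℝ)..t, k s := by
  intro t ht
  refine le_of_forall_pos_le_add fun δ hδ => ?_
  have hpos : ∀ s, 0 < ‖y s‖ ^ 2 + δ ^ 2 := fun s => by positivity
  have hf : ∀ s ∈ Icc 0 T, HasDerivWithinAt (fun s => √(‖y s‖ ^ 2 + δ ^ 2))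
      (2 * inner ℝ (y s) (g s) / (2 * √(‖y s‖ ^ 2 + δ ^ 2))) (Icc 0 T) s := fun s hs =>
    ((hy s hs).norm_sq.add_const _).sqrt (hpos s).ne'
  have hB : ∀ s ∈ Icc 0 T, HasDerivWithinAt (fun s => (∫ r in (0 : ℝ)..s, k r) + δ) (k s)
      (Icc 0 T) s := fun s hs => (hasDerivWithinAt_integral_Icc hk hs).add_const _
  have hnhds : ∀ s ∈ Ico 0 T, Icc 0 T ∈ 𝓝[Ici s] s := fun s hs => Icc_mem_nhdsGE_of_mem hs
  have key := image_le_of_deriv_right_le_deriv_boundary (a := 0) (b := T)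
    (fun s hs => (hf s hs).continuousWithinAt)
    (fun s hs => (hf s (Ico_subset_Icc_self hs)).mono_of_mem_nhdsWithin (hnhds s hs))
    (by simp [hy0, Real.sqrt_sq hδ.le])
    (fun s hs => (hB s hs).continuousWithinAt)
    (fun s hs => (hB s (Ico_subset_Icc_self hs)).mono_of_mem_nhdsWithin (hnhds s hs))
    (fun s hs => ?_) ht
  · refine le_trans (Real.le_sqrt_of_sq_le ?_) key
    nlinarith [sq_nonneg δ]
  · have hs' := Ico_subset_Icc_self hs
    rw [mul_div_mul_left _ _ two_ne_zero, div_le_iff₀ (Real.sqrt_pos.2 (hpos s)),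
      real_inner_comm]
    refine (hg s hs').trans (mul_le_mul_of_nonneg_left (Real.le_sqrt_of_sq_le ?_) (hk0 s hs'))
    nlinarith [sq_nonneg δ]

/-! ### Pathwise analysis -/

/-- The paths `W`, `v`, `C`, `Z` satisfy the integral equations of the decomposition of the
stochastic neural field on `[0, T]`. -/
structure IsPathSolution (T : ℝ) (w F U : ℝ → ℝ) (c m ε : ℝ) (W v : ℝ → L2R) (C : ℝ → ℝ)
    (Z : ℝ → L2R) : Prop where
  zero : W 0 = 0
  continuous_v : ContinuousOn v (Icc 0 T)
  eq_v : ∀ t ∈ Icc 0 T, v t = (∫ s in (0 : ℝ)..t, driftV w F U c s (v s)) + √ε • W t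
  phase : IsPhase T U c m v C
  continuous_W : ContinuousOn W (Icc 0 T)
  continuous_Z : ContinuousOn Z (Icc 0 T)
  eq_Z : ∀ t ∈ Icc 0 T, Z t = (∫ s in (0 : ℝ)..t, opA w F U m (c * s + C s) (Z s)) + W t

namespace IsPathSolution

variable {T : ℝ} {w F U : ℝ → ℝ} {c m ε : ℝ} {W v Z : ℝ → L2R} {C : ℝ → ℝ}

theorem continuous_phase (h : IsPathSolution T w F U c m ε W v C Z) : ContinuousOn C (Icc 0 T) :=
  fun t ht => (h.phase.2 t ht).continuousWithinAt

theorem continuous_opA_Z (hw : IsKernel w) (hF : IsGain F) (hU : IsTravellingWave w F c U)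
    (h : IsPathSolution T w F U c m ε W v C Z) :
    ContinuousOn (fun s => opA w F U m (c * s + C s) (Z s)) (Icc 0 T) :=
  (continuous_opA hw hF hU m).comp_continuousOn (g := fun p : ℝ × L2R => opA w F U m p.1 p.2)
    (f := fun s => (c * s + C s, Z s)) (((continuousOn_const.mul continuousOn_id).add h.continuous_phase).prodMk h.continuous_Z)

theorem continuous_drift_v (hw : IsKernel w) (hF : IsGain F) (hU : IsTravellingWave w F c U)
    (h : IsPathSolution T w F U c m ε W v C Z) :
    ContinuousOn (fun s => driftV w F U c s (v s)) (Icc 0 T) :=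
  (continuous_driftV hw hF hU).comp_continuousOn (g := fun p : ℝ × L2R => driftV w F U c p.1 p.2)
    (f := fun s => (s, v s)) (continuousOn_id.prodMk h.continuous_v)

theorem continuous_scaledFluctuation (hw : IsKernel w) (hF : IsGain F)
    (hU : IsTravellingWave w F c U) (h : IsPathSolution T w F U c m ε W v C Z) :
    ContinuousOn (fun t => scaledFluctuation U c ε t (v t) (C t)) (Icc 0 T) := by
  have hE : Continuous fun b => toL2 fun x => U x - U (x - b) := continuous_iff_continuousAt.2
    fun b => (hasDerivAt_toL2_sub hU (hU.memLp_deriv hw hF) b).continuousAt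
  simp only [scaledFluctuation, fluctuation_eq hU, toL2_sub_translate hU]
  have hct : ContinuousOn (fun t : ℝ => c * t) (Icc 0 T) := by fun_prop
  exact (h.continuous_v.add ((hE.comp_continuousOn (hct.add h.continuous_phase)).sub
    (hE.comp_continuousOn hct))).const_smul (√ε)⁻¹

/-- The energy estimate for `y`, with `k = K √ε ‖ṽ^ε‖²`: the factor `ε^{-1/2}` in front of the
remainder meets `‖ṽ‖² = ε ‖ṽ^ε‖²`. -/
theorem norm_sub_le (hw : IsKernel w) (hF : IsGain F) (hU : IsTravellingWave w F c U)
    {κ Cs : ℝ} (hκ : 0 < κ) (hgap : SpectralGap w F U κ Cs) (hm : Cs < m) (hε : 0 < ε)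
    (hT : 0 ≤ T) (h : IsPathSolution T w F U c m ε W v C Z) :
    ∀ t ∈ Icc 0 T, ‖scaledFluctuation U c ε t (v t) (C t) - Z t‖ ≤
      remainderConst w F * √ε * ∫ s in (0 : ℝ)..t, ‖scaledFluctuation U c ε s (v s) (C s)‖ ^ 2 := by
  have hs : 0 < √ε := Real.sqrt_pos.2 hε
  have hK := remainderConst_nonneg w F
  have hU2 := hU.memLp_deriv hw hF
  have h0 : (0 : ℝ) ∈ Icc 0 T := left_mem_Icc.2 hT
  have hxc := h.continuous_scaledFluctuation hw hF hU
  obtain ⟨x, hx⟩ : ∃ x : ℝ → L2R, ∀ t, x t = scaledFluctuation U c ε t (v t) (C t) :=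
    ⟨_, fun _ => rfl⟩
  have hxz : ∀ t, fluctuation U c t (v t) (C t) = √ε • x t := fun t => by
    rw [hx, scaledFluctuation, smul_inv_smul₀ hs.ne']
  simp_rw [← hx] at hxc ⊢
  simp_rw [← intervalIntegral.integral_const_mul]
  refine norm_le_integral_of_inner_deriv_le
    (g := fun t => opA w F U m (c * t + C t) (x t - Z t) +
      (√ε)⁻¹ • quadRemainder hw F U (c * t + C t) (fluctuation U c t (v t) (C t)))
    (fun t ht => ?_) ?_ (by fun_prop) (fun t _ => by positivity) (fun t ht => ?_)
  · have hct : HasDerivWithinAt (fun t : ℝ => c * t) c (Icc 0 T) t := by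
      simpa using ((hasDerivAt_id t).const_mul c).hasDerivWithinAt
    have hφ := hct.add (h.phase.2 t ht)
    have d1 := hasDerivWithinAt_integral_Icc (h.continuous_drift_v hw hF hU) ht
    have d2 := hasDerivWithinAt_integral_Icc (h.continuous_opA_Z hw hF hU) ht
    have d3 := (hasDerivAt_toL2_sub hU hU2 (c * t + C t)).scomp_hasDerivWithinAt t hφ
    have d4 := (hasDerivAt_toL2_sub hU hU2 (c * t)).scomp_hasDerivWithinAt t hct
    have d := (((d1.add (d3.sub d4)).const_smul (√ε)⁻¹).sub d2)
    rw [driftV_add_eq hw hF hU] at d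
    have e : opA w F U m (c * t + C t) (x t - Z t) +
        (√ε)⁻¹ • quadRemainder hw F U (c * t + C t) (fluctuation U c t (v t) (C t)) =
        (√ε)⁻¹ • (opA w F U m (c * t + C t) (fluctuation U c t (v t) (C t)) +
          quadRemainder hw F U (c * t + C t) (fluctuation U c t (v t) (C t))) -
        opA w F U m (c * t + C t) (Z t) := by
      rw [opA_sub hw hF hU, smul_add, ← opA_smul hw hF hU, hxz, inv_smul_smul₀ hs.ne']
      abel
    rw [e]
    refine d.congr_of_mem (fun s hs' => ?_) ht
    simp only [hx, scaledFluctuation, fluctuation_eq hU, toL2_sub_translate hU]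
    -- Inserting both integral equations, `(√ε)⁻¹ √ε W` cancels the `W` in `Z`; only differentiable
    -- terms remain.
    rw [h.eq_Z s hs']
    nth_rw 1 [h.eq_v s hs']
    simp only [Pi.sub_apply, Pi.add_apply, Pi.smul_apply, Function.comp_apply]
    rw [add_right_comm, smul_add, inv_smul_smul₀ hs.ne']
    abel
  · have hv0 : v 0 = 0 := by simpa [h.zero] using h.eq_v 0 h0
    have hZ0 : Z 0 = 0 := by simpa [h.zero] using h.eq_Z 0 h0
    simp only [hx, scaledFluctuation, fluctuation_eq hU, toL2_sub_translate hU, hv0, hZ0,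
      h.phase.1]
    simp
  · rw [inner_add_left, inner_smul_left]
    have h1 := inner_opA_nonpos hκ hgap hm (c * t + C t) (x t - Z t)
    have h2 := real_inner_le_norm
      (quadRemainder hw F U (c * t + C t) (fluctuation U c t (v t) (C t))) (x t - Z t)
    have h3 := norm_quadRemainder_le hw hF hU (c * t + C t) (fluctuation U c t (v t) (C t))
    simp only [conj_trivial]
    rw [hxz, norm_smul, Real.norm_of_nonneg hs.le] at h3
    have h4 : (√ε)⁻¹ * (remainderConst w F * (√ε * ‖x t‖) ^ 2) =
        remainderConst w F * √ε * ‖x t‖ ^ 2 := by field_simp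
    rw [← h4, mul_assoc]
    rw [hxz] at h2 ⊢
    have h5 := mul_le_mul_of_nonneg_left (h2.trans (mul_le_mul_of_nonneg_right h3
      (norm_nonneg (x t - Z t)))) (inv_nonneg.2 hs.le)
    linarith

/-- `Z - W` is differentiable with derivative `A Z = A (Z - W) + A W`. The first term is dissipative
and the second is at most `L r`. -/
theorem norm_Z_le (hw : IsKernel w) (hF : IsGain F) (hU : IsTravellingWave w F c U)
    {κ Cs : ℝ} (hκ : 0 < κ) (hgap : SpectralGap w F U κ Cs) (hm : Cs < m)
    {L : ℝ} (hL0 : 0 ≤ L) (hL : ∀ a z, ‖opA w F U m a z‖ ≤ L * ‖z‖) {r : ℝ}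
    (hr : ∀ t ∈ Icc 0 T, ‖W t‖ ≤ r) (h : IsPathSolution T w F U c m ε W v C Z) :
    ∀ t ∈ Icc 0 T, ‖Z t‖ ≤ T * (L * r) + r := by
  intro t ht
  have hT : 0 ≤ T := ht.1.trans ht.2
  have h0 : (0 : ℝ) ∈ Icc 0 T := left_mem_Icc.2 hT
  have hr0 : 0 ≤ r := (norm_nonneg _).trans (hr 0 h0)
  have key := norm_le_integral_of_inner_deriv_le (T := T) (y := fun t => Z t - W t)
    (g := fun t => opA w F U m (c * t + C t) (Z t)) (k := fun _ => L * r)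
    (fun t ht => (hasDerivWithinAt_integral_Icc (h.continuous_opA_Z hw hF hU) ht).congr_of_mem
      (fun s hs => by rw [h.eq_Z s hs, add_sub_cancel_right]) ht)
    (by simpa [h.zero] using h.eq_Z 0 h0) continuousOn_const (fun _ _ => by positivity)
    (fun t ht => ?_) t ht
  · rw [intervalIntegral.integral_const, sub_zero, smul_eq_mul] at key
    have h1 := norm_add_le (Z t - W t) (W t)
    rw [sub_add_cancel] at h1
    have h2 := mul_le_mul_of_nonneg_right ht.2 (mul_nonneg hL0 hr0)
    linarith [hr t ht]
  · have e : opA w F U m (c * t + C t) (Z t) =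
        opA w F U m (c * t + C t) (Z t - W t) + opA w F U m (c * t + C t) (W t) := by
      rw [← opA_add hw hF hU, sub_add_cancel]
    rw [e, inner_add_left]
    have h1 := inner_opA_nonpos hκ hgap hm (c * t + C t) (Z t - W t)
    have h2 := real_inner_le_norm (opA w F U m (c * t + C t) (W t)) (Z t - W t)
    have h3 := (hL (c * t + C t) (W t)).trans (mul_le_mul_of_nonneg_left (hr t ht) hL0)
    have h4 := mul_le_mul_of_nonneg_right h3 (norm_nonneg (Z t - W t))
    linarith

end IsPathSolution

/-! ### The exit time -/

section ExitTime

variable {Ω : Type*} {T R : ℝ} {x : ℝ → Ω → L2R} {ω : Ω}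

theorem continuousOn_integral_norm_sq (hx : ContinuousOn (fun t => x t ω) (Icc 0 T)) :
    ContinuousOn (fun t => ∫ s in (0 : ℝ)..t, ‖x s ω‖ ^ 2) (Icc 0 T) := fun _ ht =>
  (hasDerivWithinAt_integral_Icc (h := fun s => ‖x s ω‖ ^ 2)
    (hx.norm.pow 2) ht).continuousWithinAt

theorem exitTime_mem_Icc (hT : 0 ≤ T) : exitTime T R x ω ∈ Icc 0 T := hittingBtwn_mem_Icc hT ω

theorem integral_le_of_le_exitTime (hT : 0 ≤ T) (hR : 0 ≤ R)
    (hx : ContinuousOn (fun t => x t ω) (Icc 0 T)) {t : ℝ} (ht : t ∈ Icc 0 (exitTime T R x ω)) :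
    ∫ s in (0 : ℝ)..t, ‖x s ω‖ ^ 2 ≤ R := by
  have hlt : ∀ s ∈ Ico 0 (exitTime T R x ω), ∫ r in (0 : ℝ)..s, ‖x r ω‖ ^ 2 ≤ R := fun s hs =>
    not_lt.1 (notMem_of_lt_hittingBtwn hs.2 hs.1)
  rcases ht.2.lt_or_eq with h | h
  · exact hlt t ⟨ht.1, h⟩
  rcases ht.1.eq_or_lt with h0 | h0
  · rw [← h0, intervalIntegral.integral_same]; exact hR
  have htT : t ≤ T := ht.2.trans (exitTime_mem_Icc hT).2
  have hc : ContinuousWithinAt (fun t => ∫ s in (0 : ℝ)..t, ‖x s ω‖ ^ 2) (Ioo 0 t) t :=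
    (continuousOn_integral_norm_sq hx t ⟨h0.le, htT⟩).mono
      fun s hs => ⟨hs.1.le, hs.2.le.trans htT⟩
  have : (𝓝[Ioo 0 t] t).NeBot := right_nhdsWithin_Ioo_neBot h0
  -- At `t = τ` itself the level may be hit, so the bound comes from the left limit.
  refine le_of_tendsto hc ?_
  filter_upwards [self_mem_nhdsWithin] with s hs
  exact hlt s ⟨hs.1.le, h ▸ hs.2⟩

theorem le_integral_of_exitTime_ne (hx : ContinuousOn (fun t => x t ω) (Icc 0 T))
    (h : exitTime T R x ω ≠ T) : R ≤ ∫ s in (0 : ℝ)..exitTime T R x ω, ‖x s ω‖ ^ 2 := by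
  rw [exitTime, hittingBtwn] at h ⊢
  split_ifs at h ⊢ with hj
  · have hcl : IsClosed (Icc 0 T ∩ (fun t => ∫ s in (0 : ℝ)..t, ‖x s ω‖ ^ 2) ⁻¹' Ici R) :=
      (continuousOn_integral_norm_sq hx).preimage_isClosed_of_isClosed isClosed_Icc isClosed_Ici
    obtain ⟨j, hj, hjR⟩ := hj
    -- The level set is open, so the infimum of the hitting times lies only in its closure; hence `R
    -- ≤` and not `R <`.
    have hmem := csInf_mem_closure (s := Icc 0 T ∩ {t | ∫ s in (0 : ℝ)..t, ‖x s ω‖ ^ 2 ∈ Ioi R})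
      ⟨j, hj, hjR⟩ (bddBelow_Icc.mono inter_subset_left)
    have hsub : Icc 0 T ∩ {t | ∫ s in (0 : ℝ)..t, ‖x s ω‖ ^ 2 ∈ Ioi R} ⊆
        Icc 0 T ∩ (fun t => ∫ s in (0 : ℝ)..t, ‖x s ω‖ ^ 2) ⁻¹' Ici R :=
      fun t ht => ⟨ht.1, le_of_lt (show R < _ from ht.2)⟩
    exact (closure_minimal hsub hcl hmem).2
  · exact absurd rfl h

end ExitTime

/-! ### The stopped remainder along a path -/

section Stopped

variable {Ω : Type*} {T : ℝ} {w F U : ℝ → ℝ} {c m ε q : ℝ} {W v Z x : ℝ → Ω → L2R}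
  {C : ℝ → Ω → ℝ} {ω : Ω}

theorem norm_sub_le_of_le_exitTime (hw : IsKernel w) (hF : IsGain F)
    (hU : IsTravellingWave w F c U) {κ Cs : ℝ} (hκ : 0 < κ) (hgap : SpectralGap w F U κ Cs)
    (hm : Cs < m) (hε : 0 < ε) (hT : 0 ≤ T)
    (hx : ∀ t ω, x t ω = scaledFluctuation U c ε t (v t ω) (C t ω))
    (h : IsPathSolution T w F U c m ε (fun t => W t ω) (fun t => v t ω) (fun t => C t ω)
      fun t => Z t ω) {t : ℝ} (ht : t ∈ Icc 0 (exitTime T (ε ^ (-q)) x ω)) :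
    ‖x t ω - Z t ω‖ ≤ remainderConst w F * ε ^ (1 / 2 - q) := by
  have htT : t ∈ Icc 0 T := ⟨ht.1, ht.2.trans (exitTime_mem_Icc hT).2⟩
  have hxc := h.continuous_scaledFluctuation hw hF hU
  have h1 := h.norm_sub_le hw hF hU hκ hgap hm hε hT t htT
  simp_rw [← hx] at hxc h1
  have h2 := integral_le_of_le_exitTime hT (Real.rpow_nonneg hε.le (-q)) hxc ht
  refine h1.trans ((mul_le_mul_of_nonneg_left h2
    (mul_nonneg (remainderConst_nonneg w F) (Real.sqrt_nonneg ε))).trans_eq ?_)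
  rw [mul_assoc, Real.sqrt_eq_rpow, ← Real.rpow_add hε, ← sub_eq_add_neg]

/-- If `τ ≠ T`, the integral up to `τ` is at least `ε^{-q}`. Up to `τ`, however, `‖x‖ ≤ K + r`, so
it is at most `T (K + r)²`. -/
theorem exitTime_eq_of_bounded (hw : IsKernel w) (hF : IsGain F)
    (hU : IsTravellingWave w F c U) {κ Cs : ℝ} (hκ : 0 < κ) (hgap : SpectralGap w F U κ Cs)
    (hm : Cs < m) (hε : 0 < ε) (hε1 : ε ≤ 1) (hq : q ≤ 1 / 2) (hT : 0 ≤ T)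
    (hx : ∀ t ω, x t ω = scaledFluctuation U c ε t (v t ω) (C t ω))
    (h : IsPathSolution T w F U c m ε (fun t => W t ω) (fun t => v t ω) (fun t => C t ω)
      fun t => Z t ω) {r : ℝ} (hr : ∀ t ∈ Icc 0 T, ‖Z t ω‖ ≤ r)
    (hlarge : T * (remainderConst w F + r) ^ 2 < ε ^ (-q)) :
    exitTime T (ε ^ (-q)) x ω = T := by
  by_contra hne
  have hxc := h.continuous_scaledFluctuation hw hF hU
  simp_rw [← hx] at hxc
  have hτ : exitTime T (ε ^ (-q)) x ω ∈ Icc 0 T := exitTime_mem_Icc hT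
  have h1 := le_integral_of_exitTime_ne hxc hne
  have hb : ∀ t ∈ Icc 0 (exitTime T (ε ^ (-q)) x ω),
      ‖x t ω‖ ^ 2 ≤ (remainderConst w F + r) ^ 2 := fun t ht => by
    have h2 := norm_sub_le_of_le_exitTime hw hF hU hκ hgap hm hε hT hx h ht
    have h3 : ε ^ (1 / 2 - q) ≤ 1 := Real.rpow_le_one hε.le hε1 (by linarith)
    have h4 := mul_le_mul_of_nonneg_left h3 (remainderConst_nonneg w F)
    have h5 := norm_add_le (x t ω - Z t ω) (Z t ω)
    rw [sub_add_cancel] at h5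
    have h6 := hr t ⟨ht.1, ht.2.trans hτ.2⟩
    exact pow_le_pow_left₀ (norm_nonneg _) (by linarith) 2
  have hint : IntervalIntegrable (fun s => ‖x s ω‖ ^ 2) volume 0 (exitTime T (ε ^ (-q)) x ω) :=
    ContinuousOn.intervalIntegrable_of_Icc hτ.1
      ((hxc.mono (Icc_subset_Icc_right hτ.2)).norm.pow 2)
  have h2 := intervalIntegral.integral_mono_on hτ.1 hint intervalIntegrable_const hb
  rw [intervalIntegral.integral_const, sub_zero, smul_eq_mul] at h2
  have h3 := mul_le_mul_of_nonneg_right hτ.2 (sq_nonneg (remainderConst w F + r))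
  linarith

end Stopped

/-! ### Convergence in probability -/

/-- The events `sup ‖W‖ ≤ n` increase to a set of full measure by continuity on a compact interval,
and each is eventually inside `A ε` up to a null set. Only monotonicity of `P` is used, so `A ε`
need not be measurable. -/
theorem tendsto_measure_one_of_tight {Ω : Type*} [MeasurableSpace Ω] {P : Measure Ω}
    [IsProbabilityMeasure P] {E : Type*} [NormedAddCommGroup E] {T : ℝ} {W : ℝ → Ω → E}
    (hW : ∀ᵐ ω ∂P, ContinuousOn (fun t => W t ω) (Icc 0 T)) {l : Filter ℝ} {A : ℝ → Set Ω}
    (hA : ∀ n : ℕ, ∀ᶠ ε in l, ∀ᵐ ω ∂P, (∀ t ∈ Icc 0 T, ‖W t ω‖ ≤ n) → ω ∈ A ε) :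
    Tendsto (fun ε => P (A ε)) l (𝓝 1) := by
  let S : ℕ → Set Ω := fun n => {ω | ∀ t ∈ Icc 0 T, ‖W t ω‖ ≤ n}
  have hS : Monotone S := fun i j hij ω hω t ht => (hω t ht).trans (Nat.cast_le.2 hij)
  have hU : P (⋃ n, S n) = 1 := by
    rw [← measure_univ (μ := P)]
    refine measure_congr (eventuallyEq_univ.2 ?_)
    filter_upwards [hW] with ω hω
    obtain ⟨r, hr⟩ := isCompact_Icc.exists_bound_of_continuousOn hω
    obtain ⟨n, hn⟩ := exists_nat_ge r
    exact mem_iUnion.2 ⟨n, fun t ht => (hr t ht).trans hn⟩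
  have hlim := tendsto_measure_iUnion_atTop (μ := P) hS
  rw [hU] at hlim
  refine tendsto_order.2 ⟨fun a ha => ?_, fun a ha => Eventually.of_forall fun ε =>
    prob_le_one.trans_lt ha⟩
  obtain ⟨n, hn⟩ := (hlim.eventually (lt_mem_nhds ha)).exists
  filter_upwards [hA n] with ε hε
  exact hn.trans_le (measure_mono_ae hε)

end NeuralField

/-! ### The stability theorem -/

theorem mainTheorem1
    {Ω : Type*} [mΩ : MeasurableSpace Ω] (P : Measure Ω) [IsProbabilityMeasure P]
    (ℱ : Filtration ℝ mΩ) (T : ℝ) (hT : 0 < T)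
    (w F U : ℝ → ℝ) (c : ℝ)
    (hw : NeuralField.IsKernel w) (hF : NeuralField.IsGain F)
    (hU : NeuralField.IsTravellingWave w F c U)
    (κ Cs m : ℝ) (hκ : 0 < κ) (hCs : 0 < Cs)
    (hgap : NeuralField.SpectralGap w F U κ Cs) (hm : Cs < m)
    (Q : NeuralField.L2R →L[ℝ] NeuralField.L2R) (W : ℝ → Ω → NeuralField.L2R)
    (hW : NeuralField.IsQWiener T P ℱ Q W)
    (v : ℝ → ℝ → Ω → NeuralField.L2R) (C : ℝ → ℝ → Ω → ℝ) (Z : ℝ → ℝ → Ω → NeuralField.L2R)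
    (hv : ∀ ε, 0 < ε → NeuralField.IsStrongSolution T P ℱ W
      (fun t _ x => NeuralField.driftV w F U c t x) (Real.sqrt ε) (v ε))
    (hC : ∀ ε, 0 < ε → ∀ᵐ ω ∂P,
      NeuralField.IsPhase T U c m (fun t => v ε t ω) (fun t => C ε t ω))
    (hZ : ∀ ε, 0 < ε → NeuralField.IsStrongSolution T P ℱ W
      (fun t ω x => NeuralField.opA w F U m (c * t + C ε t ω) x) 1 (Z ε))
    (vt y : ℝ → ℝ → Ω → NeuralField.L2R)
    (hvt : ∀ ε t ω, vt ε t ω = NeuralField.scaledFluctuation U c ε t (v ε t ω) (C ε t ω))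
    (hy : ∀ ε t ω, y ε t ω = vt ε t ω - Z ε t ω)
    (q : ℝ) (hq0 : 0 < q) (hq : q < 1 / 2)
    (τ : ℝ → Ω → ℝ) (hτ : ∀ ε, τ ε = NeuralField.exitTime T (ε ^ (-q)) (vt ε)) :
    (∀ ε, 0 < ε → ∀ᵐ ω ∂P, ∀ t ∈ Icc 0 (τ ε ω),
      ‖y ε t ω‖ ≤ NeuralField.remainderConst w F * ε ^ (1 / 2 - q)) ∧
    Tendsto (fun ε => P {ω | τ ε ω = T}) (𝓝[>] 0) (𝓝 1) ∧
    Tendsto (fun ε => P {ω | ∀ t ∈ Icc 0 T,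
      ‖NeuralField.fluctuation U c t (v ε t ω) (C ε t ω) - Real.sqrt ε • Z ε t ω‖
        ≤ NeuralField.remainderConst w F * ε ^ (1 - q)}) (𝓝[>] 0) (𝓝 1) := by
  have hpath : ∀ ε, 0 < ε → ∀ᵐ ω ∂P, NeuralField.IsPathSolution T w F U c m ε (fun t => W t ω)
      (fun t => v ε t ω) (fun t => C ε t ω) (fun t => Z ε t ω) := fun ε hε => by
    filter_upwards [hW.zero, hW.continuous, (hv ε hε).continuous, (hv ε hε).equation, hC ε hε,
      (hZ ε hε).continuous, (hZ ε hε).equation] with ω h1 h2 h3 h4 h5 h6 h7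
    exact ⟨h1, h3, h4, h5, h2, h6, fun t ht => by simpa using h7 t ht⟩
  have hbound : ∀ ε, 0 < ε → ∀ᵐ ω ∂P, ∀ t ∈ Icc 0 (τ ε ω),
      ‖y ε t ω‖ ≤ NeuralField.remainderConst w F * ε ^ (1 / 2 - q) := fun ε hε => by
    filter_upwards [hpath ε hε] with ω h t ht
    rw [hτ] at ht
    rw [hy]
    exact NeuralField.norm_sub_le_of_le_exitTime hw hF hU hκ hgap hm hε hT.le (hvt ε) h ht
  have hexit : ∀ n : ℕ, ∀ᶠ ε in 𝓝[>] 0, ∀ᵐ ω ∂P, (∀ t ∈ Icc 0 T, ‖W t ω‖ ≤ n) →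
      τ ε ω = T := fun n => by
    obtain ⟨L, hL0, hL⟩ := NeuralField.exists_norm_opA_le hw hF hU m
    filter_upwards [self_mem_nhdsWithin, Ioc_mem_nhdsGT (zero_lt_one' ℝ),
      -- The threshold is `T (K + r)²` with `r = T L n + n`, the bound on `Z` when `sup ‖W‖ ≤ n`;
      -- `ε^{-q}` eventually exceeds it.
      (tendsto_rpow_neg_nhdsGT_zero (neg_lt_zero.2 hq0)).eventually_gt_atTop
        (T * (NeuralField.remainderConst w F + (T * (L * n) + n)) ^ 2)] with ε hε hε1 hlarge
    filter_upwards [hpath ε hε] with ω h hn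
    rw [hτ]
    exact NeuralField.exitTime_eq_of_bounded hw hF hU hκ hgap hm hε hε1.2 hq.le hT.le (hvt ε) h
      (h.norm_Z_le hw hF hU hκ hgap hm hL0 hL hn) hlarge
  refine ⟨hbound, NeuralField.tendsto_measure_one_of_tight hW.continuous hexit,
    NeuralField.tendsto_measure_one_of_tight hW.continuous fun n => ?_⟩
  filter_upwards [self_mem_nhdsWithin, hexit n] with ε hε h
  filter_upwards [h, hbound ε hε] with ω h1 h2 hn t ht
  have hε0 : 0 < ε := hε
  have hs : 0 < √ε := Real.sqrt_pos.2 hε0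
  -- The remainder `r_t` is `√ε y_t`, so on `τ = T` the first claim gains a factor `ε^{1/2}`.
  have e : NeuralField.fluctuation U c t (v ε t ω) (C ε t ω) - √ε • Z ε t ω =
      √ε • y ε t ω := by
    rw [hy, hvt, NeuralField.scaledFluctuation, smul_sub, smul_inv_smul₀ hs.ne']
  rw [e, norm_smul, Real.norm_of_nonneg hs.le]
  have h3 := h2 t (by rwa [h1 hn])
  refine (mul_le_mul_of_nonneg_left h3 hs.le).trans_eq ?_
  rw [mul_left_comm, Real.sqrt_eq_rpow, ← Real.rpow_add hε0]
  congr 2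
  ring
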